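/- For an integer $k\ge 0$, a $k$-b-coloring of a finite simple graph $G$ is a map $\chi\colon V(G)\to\{1,\dots,k\}$ such that adjacent vertices receive different colors and, for every color $c\in\{1,\dots,k\}$, there is a vertex $u$ with $\chi(u)=c$ and $\chi(N[u])=\{1,\dots,k\}$, where $N[u]$ is the closed neighborhood of $u$. The $b$-Coloring problem receives a finite simple graph $G$ and an integer $k\ge 0$ and asks whether $G$ has a $k$-b-coloring. The distance to co-cluster of $G$ is the smallest size of a set $S\subseteq V(G)$ such that $G-S$ is a complete multipartite graph (that is, the complement of a disjoint union of cliques). Theorem. The $b$-Coloring problem can be solved in time $2^{2^{\mathcal O(p)}}\cdot n^{\mathcal O(1)}$, where $n$ is the number of vertices and $p$ is the distance to co-cluster of the input graph. That is, there are a single deterministic algorithm and a constant $C$ such that, for every graph $G$ on $n\ge 0$ vertices (given by $n$ and its adjacency matrix) and every integer $k\ge 0$, the algorithm halts on $(G,k)$ after at most $C\cdot 2^{2^{C p}}\cdot (n+1)^{C}$ steps and correctly decides whether $G$ has a $k$-b-coloring. The algorithm is not given $p$. Steps are counted on a random access machine over the natural numbers whose unit-cost arithmetic operations are addition and truncated subtraction.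 -/

import Mathlib

/-! ### b-colorings -/

namespace BColoring

/-- A `k`-coloring `χ` is *proper* if adjacent vertices receive different colors. -/
def IsProper {V : Type*} (G : SimpleGraph V) {k : ℕ} (χ : V → Fin k) : Prop :=
  ∀ u v : V, G.Adj u v → χ u ≠ χ v

/-- `u` is a *b-vertex* in the `k`-coloring `χ` if all `k` colors occur on the closed
neighborhood of `u`. -/
def IsBVertex {V : Type*} (G : SimpleGraph V) {k : ℕ} (χ : V → Fin k) (u : V) : Prop :=
  χ '' (insert u (G.neighborSet u)) = Set.univ

/-- A `k`-b-coloring: a proper `k`-coloring in which every color is the color of some b-vertex. -/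
def IsBColoring {V : Type*} (G : SimpleGraph V) {k : ℕ} (χ : V → Fin k) : Prop :=
  IsProper G χ ∧ ∀ c : Fin k, ∃ u : V, χ u = c ∧ IsBVertex G χ u

/-- `G` admits a b-coloring with exactly `k` colors. -/
def HasBColoring {V : Type*} (G : SimpleGraph V) (k : ℕ) : Prop :=
  ∃ χ : V → Fin k, IsBColoring G χ

/-! ### Distance to co-cluster -/

/-- `S` is a *co-cluster-modulator* of `G` if `G - S` is a co-cluster graph, that is, a complete
multipartite graph. -/
def IsCoclusterModulator {V : Type*} (G : SimpleGraph V) (S : Finset V) : Prop :=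
  (G.induce ((S : Set V)ᶜ)).IsCompleteMultipartite

/-- The *distance to co-cluster* of a finite graph: the size of a minimum co-cluster-modulator.
(The set of sizes is nonempty, since all vertices together form a modulator.) -/
noncomputable def distToCocluster {V : Type*} [Fintype V] (G : SimpleGraph V) : ℕ :=
  sInf {m : ℕ | ∃ S : Finset V, IsCoclusterModulator G S ∧ S.card = m}

end BColoring

/-! ### Random access machine

Structured (goto-free) programs for a random access machine on natural numbers, with addition and
truncated subtraction as its only arithmetic operations. Every program mentions finitely many
scalar registers and finitely many arrays; arrays are read and written with computed addresses.
The running time is the number of executed assignments and evaluated loop and branch conditions.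
An expression is a fixed part of the program, so evaluating it takes a constant number of
elementary operations. There is no unit-cost multiplication or shift, so the bit length of the
stored numbers grows by at most a constant per step, and the step count is polynomially related
to the running time of a Turing machine. -/

namespace RAM

/-- A memory state: the contents of the scalar registers and of the arrays. -/
structure State where
  reg : ℕ → ℕ
  arr : ℕ → ℕ → ℕ

/-- Expressions. -/
inductive Expr where
  /-- a numeral -/
  | const (m : ℕ)
  /-- the content of register `x` -/
  | reg (x : ℕ)
  /-- the entry of array `a` at the address given by `e` -/
  | get (a : ℕ) (e : Expr)
  /-- addition -/
  | add (e₁ e₂ : Expr)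
  /-- truncated subtraction -/
  | sub (e₁ e₂ : Expr)

/-- The value of an expression in a memory state. -/
def Expr.eval (s : State) : Expr → ℕ
  | .const m => m
  | .reg x => s.reg x
  | .get a e => s.arr a (e.eval s)
  | .add e₁ e₂ => e₁.eval s + e₂.eval s
  | .sub e₁ e₂ => e₁.eval s - e₂.eval s

/-- Write `v` to register `x`. -/
def State.setReg (s : State) (x v : ℕ) : State :=
  { s with reg := Function.update s.reg x v }

/-- Write `v` to address `i` of array `a`. -/
def State.setArr (s : State) (a i v : ℕ) : State :=
  { s with arr := Function.update s.arr a (Function.update (s.arr a) i v) }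

/-- Programs. -/
inductive Prog where
  /-- do nothing -/
  | skip
  /-- `x := e` -/
  | set (x : ℕ) (e : Expr)
  /-- `a[e₁] := e₂` -/
  | put (a : ℕ) (e₁ e₂ : Expr)
  /-- first `p`, then `q` -/
  | seq (p q : Prog)
  /-- `p` if `e` is nonzero, otherwise `q` -/
  | ite (e : Expr) (p q : Prog)
  /-- repeat `p` as long as `e` is nonzero -/
  | loop (e : Expr) (p : Prog)

/-- `Exec p s s' t`: started in state `s`, program `p` halts in state `s'` after `t` steps. -/
inductive Exec : Prog → State → State → ℕ → Prop where
  | skip (s : State) : Exec .skip s s 1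
  | set (x : ℕ) (e : Expr) (s : State) :
      Exec (.set x e) s (s.setReg x (e.eval s)) 1
  | put (a : ℕ) (e₁ e₂ : Expr) (s : State) :
      Exec (.put a e₁ e₂) s (s.setArr a (e₁.eval s) (e₂.eval s)) 1
  | seq {p q : Prog} {s₁ s₂ s₃ : State} {t₁ t₂ : ℕ} :
      Exec p s₁ s₂ t₁ → Exec q s₂ s₃ t₂ → Exec (.seq p q) s₁ s₃ (t₁ + t₂)
  | ite_true {e : Expr} {p q : Prog} {s s' : State} {t : ℕ} :
      e.eval s ≠ 0 → Exec p s s' t → Exec (.ite e p q) s s' (t + 1)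
  | ite_false {e : Expr} {p q : Prog} {s s' : State} {t : ℕ} :
      e.eval s = 0 → Exec q s s' t → Exec (.ite e p q) s s' (t + 1)
  | loop_done {e : Expr} {p : Prog} {s : State} :
      e.eval s = 0 → Exec (.loop e p) s s 1
  | loop_step {e : Expr} {p : Prog} {s₁ s₂ s₃ : State} {t₁ t₂ : ℕ} :
      e.eval s₁ ≠ 0 → Exec p s₁ s₂ t₁ → Exec (.loop e p) s₂ s₃ t₂ →
      Exec (.loop e p) s₁ s₃ (t₁ + t₂ + 1)

open Classical in
/-- The initial memory for the input consisting of a graph `G` on `n` vertices and a number `k`: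
register `0` holds `n`, register `1` holds `k`, array `0` holds the `n × n` adjacency matrix of `G`
row by row (the entry of the pair `(i, j)` is at address `i * n + j`), and everything else is
zero. -/
noncomputable def graphInput {n : ℕ} (G : SimpleGraph (Fin n)) (k : ℕ) : State where
  reg x := if x = 0 then n else if x = 1 then k else 0
  arr a m :=
    if a = 0 ∧ ∃ i j : Fin n, G.Adj i j ∧ m = (i : ℕ) * n + (j : ℕ) then 1 else 0

/-- Program `p` decides the proposition `P` on input `s` within `T` steps: it halts after at most
`T` steps, and then register `0` holds `1` if `P` is true and `0` if `P` is false. -/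
def DecidesWithin (p : Prog) (s : State) (P : Prop) (T : ℕ) : Prop :=
  ∃ (s' : State) (t : ℕ), Exec p s s' t ∧ t ≤ T ∧
    (P → s'.reg 0 = 1) ∧ (¬ P → s'.reg 0 = 0)

end RAM

/-! Choose greedily a maximal family of pairwise disjoint obstructions, each an edge together with a
vertex adjacent to neither end. Every modulator meets each of them, so the set of m marked vertices
satisfies m ≤ 3p. By maximality, the unmarked vertices induce a complete multipartite graph.

Fix a b-coloring. Two unmarked vertices of the same color lie in the same part. Call a color private
if it avoids the marked vertices. Private colors live in a single part, and so do their b-vertices;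
as parts are independent, a b-vertex of one private color sees no other private color of its part.
Hence each part has at most one private color. The coloring is therefore described by labels 0, ...,
m, where labels below m stand for the colors of marked vertices and m means "the private color of my
part".

What has to be known globally is a bit matrix τ of tasks with m + 3 rows. For a < m, entry (a, d)
says that the marked vertex of rank a has an unmarked neighbor of color d. Row m says that d occurs
on an unmarked vertex, and row m + 1 that d has an unmarked b-vertex. A color d < m occurs in at
most one part, so τ is a disjoint union of matrices of the parts; conversely, disjointness of row m
makes the coloring proper between parts. Within a part, the tasks are again distributed disjointly
over vertices that serve as witnesses. Row m + 2 is for counting: each part without a private color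
owns exactly one token there, so the number of private colors is the number of parts minus the
number of tokens.

Both distributions are instances of `BitPartition`, solved by dynamic programming in time polynomial
in the values of the numbers involved (`PolyDec.bitPartition`). All guessed numbers are below
2^((m+3)(m+1)), so the search takes time polynomial in n and in this power (`exists_prog`), which is
stronger than the doubly exponential bound claimed. Correctness is
`exists_natBColoring_of_hasCertificate` and `hasCertificate_of_isNatBColoring`.

Programs are never written out for these predicates. `PolyTime` and `PolyDec` are closed under
arithmetic, bounded quantifiers, bounded recursion and table filling, and each predicate is decided
by composing these rules. -/

namespace RAM

/-! ### Running time of programs -/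

/-- Started in `s`, the program `p` halts within `T` steps in a state satisfying `Q`. -/
def Runs (p : Prog) (s : State) (T : ℕ) (Q : State → Prop) : Prop :=
  ∃ s' t, Exec p s s' t ∧ t ≤ T ∧ Q s'

theorem Runs.mono {p : Prog} {s : State} {T T' : ℕ} {Q Q' : State → Prop} (h : Runs p s T Q)
    (hT : T ≤ T') (hQ : ∀ s', Q s' → Q' s') : Runs p s T' Q' := by
  obtain ⟨s', t, h1, h2, h3⟩ := h
  exact ⟨s', t, h1, h2.trans hT, hQ _ h3⟩

theorem Runs.set {x : ℕ} {e : Expr} {s : State} {Q : State → Prop}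
    (h : Q (s.setReg x (e.eval s))) : Runs (.set x e) s 1 Q :=
  ⟨_, _, .set _ _ _, le_rfl, h⟩

theorem Runs.put {a : ℕ} {e₁ e₂ : Expr} {s : State} {Q : State → Prop}
    (h : Q (s.setArr a (e₁.eval s) (e₂.eval s))) : Runs (.put a e₁ e₂) s 1 Q :=
  ⟨_, _, .put _ _ _ _, le_rfl, h⟩

theorem Runs.seq {p q : Prog} {s : State} {T₁ T₂ : ℕ} {Q : State → Prop}
    (h : Runs p s T₁ fun s' => Runs q s' T₂ Q) : Runs (.seq p q) s (T₁ + T₂) Q := by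
  obtain ⟨s', t, h1, h2, s'', t', h3, h4, h5⟩ := h
  exact ⟨s'', t + t', .seq h1 h3, by omega, h5⟩

theorem Runs.ite {e : Expr} {p q : Prog} {s : State} {T : ℕ} {Q : State → Prop}
    (h₁ : e.eval s ≠ 0 → Runs p s T Q) (h₂ : e.eval s = 0 → Runs q s T Q) :
    Runs (.ite e p q) s (T + 1) Q := by
  by_cases h : e.eval s = 0
  · obtain ⟨s', t, h3, h4, h5⟩ := h₂ h
    exact ⟨s', t + 1, .ite_false h h3, by omega, h5⟩
  · obtain ⟨s', t, h3, h4, h5⟩ := h₁ h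
    exact ⟨s', t + 1, .ite_true h h3, by omega, h5⟩

/-- Indexing the invariant by the number of completed rounds fixes the iteration count to N, so
termination, time and result come from one induction on the remaining rounds. -/
theorem Runs.loop {e : Expr} {p : Prog} {T : ℕ} (I : ℕ → State → Prop) (N : ℕ)
    (hstep : ∀ j < N, ∀ s, I j s → e.eval s ≠ 0 ∧ Runs p s T (I (j + 1)))
    (hdone : ∀ s, I N s → e.eval s = 0) {s : State} (hs : I 0 s) :
    Runs (.loop e p) s (N * (T + 1) + 1) (I N) := by
  have key : ∀ d j, j + d = N → ∀ s, I j s →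
      Runs (.loop e p) s (d * (T + 1) + 1) (I N) := by
    intro d
    induction d with
    | zero =>
      intro j hj s hs
      obtain rfl : j = N := by omega
      exact ⟨s, 1, .loop_done (hdone s hs), by omega, hs⟩
    | succ d ih =>
      intro j hj s hs
      obtain ⟨h1, s', t, h2, h3, h4⟩ := hstep j (by omega) s hs
      obtain ⟨s'', t', h5, h6, h7⟩ := ih (j + 1) (by omega) s' h4
      refine ⟨s'', t + t' + 1, .loop_step h1 h2 h5, ?_, h7⟩
      have : (d + 1) * (T + 1) = d * (T + 1) + (T + 1) := by ring
      omega
  exact key N 0 (by omega) s hs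

/-- The states `s` and `s'` agree on the registers below `r` and on the arrays below `a`. -/
def Agree (r a : ℕ) (s s' : State) : Prop :=
  (∀ i < r, s'.reg i = s.reg i) ∧ ∀ b < a, s'.arr b = s.arr b

theorem Agree.refl (r a : ℕ) (s : State) : Agree r a s s := ⟨fun _ _ => rfl, fun _ _ => rfl⟩

theorem Agree.trans {r a : ℕ} {s₁ s₂ s₃ : State} (h₁ : Agree r a s₁ s₂) (h₂ : Agree r a s₂ s₃) :
    Agree r a s₁ s₃ :=
  ⟨fun i hi => (h₂.1 i hi).trans (h₁.1 i hi), fun b hb => (h₂.2 b hb).trans (h₁.2 b hb)⟩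

theorem Agree.mono {r a r' a' : ℕ} {s s' : State} (h : Agree r' a' s s') (hr : r ≤ r')
    (ha : a ≤ a') : Agree r a s s' :=
  ⟨fun i hi => h.1 i (by omega), fun b hb => h.2 b (by omega)⟩

theorem Agree.setReg {r a x v : ℕ} {s s' : State} (h : Agree r a s s') (hx : r ≤ x) :
    Agree r a s (s'.setReg x v) := by
  refine ⟨fun i hi => ?_, h.2⟩
  rw [← h.1 i hi]
  exact Function.update_of_ne (by omega) _ _

theorem Agree.setArr {r a b i v : ℕ} {s s' : State} (h : Agree r a s s') (hb : a ≤ b) :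
    Agree r a s (s'.setArr b i v) := by
  refine ⟨h.1, fun c hc => ?_⟩
  rw [← h.2 c hc]
  exact Function.update_of_ne (by omega) _ _

@[simp] theorem State.setReg_reg (s : State) (x v i : ℕ) :
    (s.setReg x v).reg i = if i = x then v else s.reg i := by
  simp [State.setReg, Function.update_apply]

@[simp] theorem State.setReg_arr (s : State) (x v : ℕ) : (s.setReg x v).arr = s.arr := rfl

@[simp] theorem State.setArr_reg (s : State) (b i v : ℕ) : (s.setArr b i v).reg = s.reg := rfl

theorem State.setArr_arr (s : State) (b i v j : ℕ) :
    (s.setArr b i v).arr b j = if j = i then v else s.arr b j := by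
  simp [State.setArr, Function.update_apply]

/-! ### Contexts: tuples of numbers and sets of numbers stored in the memory -/

/-- A *context* is a type of tuples of numbers and sets of numbers. A *layout* says in which
registers and arrays the components are stored. -/
class Ctx (Γ : Type) where
  /-- the possible layouts -/
  Layout : Type
  /-- the layout uses only registers below `r` and arrays below `a` -/
  Below : Layout → ℕ → ℕ → Prop
  /-- the tuple is stored in the memory in the given layout -/
  Rep : Layout → State → Γ → Prop
  /-- the sum of all numbers of the tuple -/
  size : Γ → ℕ
  below_mono : ∀ {ℓ r a r' a'}, Below ℓ r a → r ≤ r' → a ≤ a' → Below ℓ r' a'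
  rep_congr : ∀ {ℓ r a s s' γ}, Below ℓ r a → Rep ℓ s γ → Agree r a s s' → Rep ℓ s' γ

instance : Ctx Unit where
  Layout := Unit
  Below _ _ _ := True
  Rep _ _ _ := True
  size _ := 0
  below_mono := fun _ _ _ => trivial
  rep_congr := fun _ _ _ => trivial

instance {Γ : Type} [Ctx Γ] : Ctx (Γ × ℕ) where
  Layout := Ctx.Layout Γ × ℕ
  Below ℓ r a := Ctx.Below ℓ.1 r a ∧ ℓ.2 < r
  Rep ℓ s γ := Ctx.Rep ℓ.1 s γ.1 ∧ s.reg ℓ.2 = γ.2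
  size γ := Ctx.size γ.1 + γ.2
  below_mono := fun h hr ha => ⟨Ctx.below_mono h.1 hr ha, by omega⟩
  rep_congr := fun h hs hA => ⟨Ctx.rep_congr h.1 hs.1 hA, (hA.1 _ h.2).trans hs.2⟩

instance {Γ : Type} [Ctx Γ] : Ctx (Γ × (ℕ → Prop)) where
  Layout := Ctx.Layout Γ × ℕ
  Below ℓ r a := Ctx.Below ℓ.1 r a ∧ ℓ.2 < a
  Rep ℓ s γ := Ctx.Rep ℓ.1 s γ.1 ∧ ∀ i, s.arr ℓ.2 i ≠ 0 ↔ γ.2 i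
  size γ := Ctx.size γ.1
  below_mono := fun h hr ha => ⟨Ctx.below_mono h.1 hr ha, by omega⟩
  rep_congr := fun h hs hA => ⟨Ctx.rep_congr h.1 hs.1 hA, by rw [hA.2 _ h.2]; exact hs.2⟩

variable {Γ : Type} [Ctx Γ]

@[simp] theorem Ctx.size_nat (γ : Γ × ℕ) : Ctx.size γ = Ctx.size γ.1 + γ.2 := rfl

@[simp] theorem Ctx.size_set (γ : Γ × (ℕ → Prop)) : Ctx.size γ = Ctx.size γ.1 := rfl

/-! ### Polynomially bounded functions -/

/-- `f` is bounded by a polynomial in the size of the context. -/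
def PolyBdd (f : Γ → ℕ) : Prop := ∃ C : ℕ, ∀ γ, f γ ≤ (Ctx.size γ + 2) ^ C

theorem PolyBdd.mono {f g : Γ → ℕ} (hg : PolyBdd g) (h : ∀ γ, f γ ≤ g γ) : PolyBdd f := by
  obtain ⟨C, hC⟩ := hg
  exact ⟨C, fun γ => (h γ).trans (hC γ)⟩

theorem PolyBdd.const (c : ℕ) : PolyBdd fun _ : Γ => c :=
  -- The base size + 2 is at least 2, so c < 2 ^ c lets the constant itself serve as exponent.
  ⟨c, fun γ => (Nat.lt_two_pow_self).le.trans (Nat.pow_le_pow_left (by omega) _)⟩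

theorem PolyBdd.size : PolyBdd fun γ : Γ => Ctx.size γ :=
  ⟨1, fun γ => by simp⟩

theorem PolyBdd.mul {f g : Γ → ℕ} (hf : PolyBdd f) (hg : PolyBdd g) :
    PolyBdd fun γ => f γ * g γ := by
  obtain ⟨C, hC⟩ := hf
  obtain ⟨D, hD⟩ := hg
  exact ⟨C + D, fun γ => by rw [pow_add]; exact Nat.mul_le_mul (hC γ) (hD γ)⟩

theorem PolyBdd.add {f g : Γ → ℕ} (hf : PolyBdd f) (hg : PolyBdd g) :
    PolyBdd fun γ => f γ + g γ := by
  obtain ⟨C, hC⟩ := hf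
  obtain ⟨D, hD⟩ := hg
  refine ⟨C + D + 1, fun γ => ?_⟩
  have h1 : (Ctx.size γ + 2) ^ C ≤ (Ctx.size γ + 2) ^ (C + D) :=
    Nat.pow_le_pow_right (by omega) (by omega)
  have h2 : (Ctx.size γ + 2) ^ D ≤ (Ctx.size γ + 2) ^ (C + D) :=
    Nat.pow_le_pow_right (by omega) (by omega)
  have h3 := hC γ
  have h4 := hD γ
  rw [pow_succ]
  -- With X = size + 2 ≥ 2, the sum is at most 2 X^(C+D) ≤ X^(C+D+1).
  nlinarith [Nat.zero_le ((Ctx.size γ + 2) ^ (C + D) * Ctx.size γ)]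

theorem PolyBdd.pow {f : Γ → ℕ} (hf : PolyBdd f) (D : ℕ) : PolyBdd fun γ => f γ ^ D := by
  obtain ⟨C, hC⟩ := hf
  exact ⟨C * D, fun γ => by rw [pow_mul]; exact Nat.pow_le_pow_left (hC γ) _⟩

theorem PolyBdd.fst {f : Γ → ℕ} (hf : PolyBdd f) : PolyBdd fun γ : Γ × ℕ => f γ.1 := by
  obtain ⟨C, hC⟩ := hf
  exact ⟨C, fun γ => (hC γ.1).trans (Nat.pow_le_pow_left (by simp) _)⟩

theorem PolyBdd.fst' {f : Γ → ℕ} (hf : PolyBdd f) :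
    PolyBdd fun γ : Γ × (ℕ → Prop) => f γ.1 := by
  obtain ⟨C, hC⟩ := hf
  exact ⟨C, fun γ => hC γ.1⟩

/-- A polynomially bounded function of `γ` and a number is bounded polynomially in terms of `γ`, as
long as the number is. -/
theorem PolyBdd.exists_bound {f : Γ × ℕ → ℕ} {b : Γ → ℕ} (hf : PolyBdd f) (hb : PolyBdd b) :
    ∃ g : Γ → ℕ, PolyBdd g ∧ ∀ γ, ∀ j ≤ b γ, f (γ, j) ≤ g γ := by
  obtain ⟨C, hC⟩ := hf
  refine ⟨fun γ => (Ctx.size γ + b γ + 2) ^ C, ((PolyBdd.size.add hb).add (.const 2)).pow C, ?_⟩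
  intro γ j hj
  exact (hC _).trans (Nat.pow_le_pow_left (by simp; omega) _)

/-! ### Functions computable in polynomial time -/

/-- `f` can be computed in time polynomial in the size of the context (where all numbers are
measured by their value), and its values are polynomially bounded as well. -/
def PolyTime (f : Γ → ℕ) : Prop :=
  PolyBdd f ∧ ∃ T : Γ → ℕ, PolyBdd T ∧ ∀ (ℓ : Ctx.Layout Γ) (r a : ℕ), Ctx.Below ℓ r a →
    ∃ p, ∀ γ s, Ctx.Rep ℓ s γ → Runs p s (T γ) fun s' => s'.reg r = f γ ∧ Agree r a s s'

theorem PolyTime.congr {f g : Γ → ℕ} (hf : PolyTime f) (h : ∀ γ, f γ = g γ) : PolyTime g := by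
  rwa [← funext h]

theorem PolyTime.const (c : ℕ) : PolyTime fun _ : Γ => c := by
  refine ⟨.const c, fun _ => 1, .const 1, fun ℓ r a _ => ⟨.set r (.const c), fun γ s _ => ?_⟩⟩
  exact Runs.set ⟨by simp [Expr.eval], (Agree.refl _ _ _).setReg le_rfl⟩

theorem PolyTime.snd : PolyTime fun γ : Γ × ℕ => γ.2 := by
  refine ⟨PolyBdd.size.mono fun γ => by simp, fun _ => 1, .const 1,
    fun ℓ r a _ => ⟨.set r (.reg ℓ.2), fun γ s h => ?_⟩⟩
  exact Runs.set ⟨by simpa [Expr.eval] using h.2, (Agree.refl _ _ _).setReg le_rfl⟩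

theorem PolyTime.fst {f : Γ → ℕ} (hf : PolyTime f) : PolyTime fun γ : Γ × ℕ => f γ.1 := by
  obtain ⟨hf, T, hT, h⟩ := hf
  refine ⟨hf.fst, _, hT.fst, fun ℓ r a hℓ => ?_⟩
  obtain ⟨p, hp⟩ := h ℓ.1 r a hℓ.1
  exact ⟨p, fun γ s hs => hp _ _ hs.1⟩

theorem PolyTime.fst' {f : Γ → ℕ} (hf : PolyTime f) :
    PolyTime fun γ : Γ × (ℕ → Prop) => f γ.1 := by
  obtain ⟨hf, T, hT, h⟩ := hf
  refine ⟨hf.fst', _, hT.fst', fun ℓ r a hℓ => ?_⟩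
  obtain ⟨p, hp⟩ := h ℓ.1 r a hℓ.1
  exact ⟨p, fun γ s hs => hp _ _ hs.1⟩

/-- Evaluate two functions into the registers `r` and `r + 1`. -/
theorem PolyTime.pair {f g : Γ → ℕ} (hf : PolyTime f) (hg : PolyTime g) :
    ∃ T : Γ → ℕ, PolyBdd T ∧ ∀ (ℓ : Ctx.Layout Γ) (r a : ℕ), Ctx.Below ℓ r a →
      ∃ p, ∀ γ s, Ctx.Rep ℓ s γ → Runs p s (T γ) fun s' =>
        s'.reg r = f γ ∧ s'.reg (r + 1) = g γ ∧ Agree r a s s' := by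
  obtain ⟨-, T, hT, hf⟩ := hf
  obtain ⟨-, T', hT', hg⟩ := hg
  refine ⟨_, hT.add hT', fun ℓ r a hℓ => ?_⟩
  obtain ⟨p, hp⟩ := hf ℓ r a hℓ
  obtain ⟨q, hq⟩ := hg ℓ (r + 1) a (Ctx.below_mono hℓ (by omega) le_rfl)
  refine ⟨.seq p q, fun γ s hs => Runs.seq ((hp γ s hs).mono le_rfl ?_)⟩
  rintro s₁ ⟨h1, h2⟩
  refine (hq γ s₁ (Ctx.rep_congr hℓ hs h2)).mono le_rfl ?_
  rintro s₂ ⟨h3, h4⟩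
  exact ⟨(h4.1 r (by omega)).trans h1, h3, h2.trans (h4.mono (by omega) le_rfl)⟩

theorem PolyTime.add {f g : Γ → ℕ} (hf : PolyTime f) (hg : PolyTime g) :
    PolyTime fun γ => f γ + g γ := by
  obtain ⟨T, hT, h⟩ := hf.pair hg
  refine ⟨hf.1.add hg.1, _, hT.add (.const 1), fun ℓ r a hℓ => ?_⟩
  obtain ⟨p, hp⟩ := h ℓ r a hℓ
  refine ⟨.seq p (.set r (.add (.reg r) (.reg (r + 1)))), fun γ s hs =>
    Runs.seq ((hp γ s hs).mono le_rfl ?_)⟩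
  rintro s' ⟨h1, h2, h3⟩
  exact Runs.set ⟨by simp [Expr.eval, h1, h2], h3.setReg le_rfl⟩

theorem PolyTime.sub {f g : Γ → ℕ} (hf : PolyTime f) (hg : PolyTime g) :
    PolyTime fun γ => f γ - g γ := by
  obtain ⟨T, hT, h⟩ := hf.pair hg
  refine ⟨hf.1.mono fun γ => Nat.sub_le _ _, _, hT.add (.const 1), fun ℓ r a hℓ => ?_⟩
  obtain ⟨p, hp⟩ := h ℓ r a hℓ
  refine ⟨.seq p (.set r (.sub (.reg r) (.reg (r + 1)))), fun γ s hs =>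
    Runs.seq ((hp γ s hs).mono le_rfl ?_)⟩
  rintro s' ⟨h1, h2, h3⟩
  exact Runs.set ⟨by simp [Expr.eval, h1, h2], h3.setReg le_rfl⟩

open Classical in
/-- The predicate `P` can be decided in time polynomial in the size of the context. -/
def PolyDec (P : Γ → Prop) : Prop := PolyTime fun γ => if P γ then 1 else 0

theorem PolyDec.congr {P Q : Γ → Prop} (hP : PolyDec P) (h : ∀ γ, P γ ↔ Q γ) : PolyDec Q := by
  rwa [← funext fun γ => propext (h γ)]

theorem PolyDec.fst {P : Γ → Prop} (hP : PolyDec P) : PolyDec fun γ : Γ × ℕ => P γ.1 :=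
  PolyTime.fst hP

open Classical in
theorem PolyTime.ite {P : Γ → Prop} {f g : Γ → ℕ} (hP : PolyDec P) (hf : PolyTime f)
    (hg : PolyTime g) : PolyTime fun γ => if P γ then f γ else g γ := by
  obtain ⟨-, T₁, hT₁, hP⟩ := hP
  obtain ⟨hf', T₂, hT₂, hf⟩ := hf
  obtain ⟨hg', T₃, hT₃, hg⟩ := hg
  refine ⟨(hf'.add hg').mono fun γ => by split_ifs <;> omega, _,
    hT₁.add ((hT₂.add hT₃).add (.const 1)), fun ℓ r a hℓ => ?_⟩
  obtain ⟨p₁, hp₁⟩ := hP ℓ r a hℓ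
  obtain ⟨p₂, hp₂⟩ := hf ℓ r a hℓ
  obtain ⟨p₃, hp₃⟩ := hg ℓ r a hℓ
  refine ⟨.seq p₁ (.ite (.reg r) p₂ p₃), fun γ s hs => Runs.seq ((hp₁ γ s hs).mono le_rfl ?_)⟩
  rintro s₁ ⟨h1, h2⟩
  have hs₁ := Ctx.rep_congr hℓ hs h2
  refine Runs.ite (fun h => ?_) fun h => ?_
  · refine (hp₂ γ s₁ hs₁).mono (by omega) ?_
    rintro s₂ ⟨h3, h4⟩
    have : P γ := by by_contra hn; simp [Expr.eval, h1, hn] at h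
    exact ⟨by simpa [this] using h3, h2.trans h4⟩
  · refine (hp₃ γ s₁ hs₁).mono (by omega) ?_
    rintro s₂ ⟨h3, h4⟩
    have : ¬ P γ := by intro hn; simp [Expr.eval, h1, hn] at h
    exact ⟨by simpa [this] using h3, h2.trans h4⟩

/-- Local definition of a number. -/
theorem PolyTime.letNat {f : Γ → ℕ} {g : Γ × ℕ → ℕ} (hf : PolyTime f) (hg : PolyTime g) :
    PolyTime fun γ => g (γ, f γ) := by
  obtain ⟨hf', T, hT, hf⟩ := hf
  obtain ⟨hg', T', hT', hg⟩ := hg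
  obtain ⟨B, hB, hgB⟩ := hg'.exists_bound hf'
  obtain ⟨B', hB', hTB⟩ := hT'.exists_bound hf'
  refine ⟨hB.mono fun γ => hgB γ _ le_rfl, _, (hT.add hB').add (.const 1), fun ℓ r a hℓ => ?_⟩
  obtain ⟨p, hp⟩ := hf ℓ r a hℓ
  obtain ⟨q, hq⟩ := hg (ℓ, r) (r + 1) a ⟨Ctx.below_mono hℓ (by omega) le_rfl, by simp⟩
  refine ⟨.seq (.seq p q) (.set r (.reg (r + 1))), fun γ s hs =>
    Runs.seq (Runs.seq ((hp γ s hs).mono le_rfl ?_))⟩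
  rintro s₁ ⟨h1, h2⟩
  refine (hq (γ, f γ) s₁ ⟨Ctx.rep_congr hℓ hs h2, h1⟩).mono (hTB γ _ le_rfl) ?_
  rintro s₂ ⟨h3, h4⟩
  exact Runs.set ⟨by simpa [Expr.eval] using h3,
    (h2.trans (h4.mono (by omega) le_rfl)).setReg le_rfl⟩

theorem PolyDec.letNat {f : Γ → ℕ} {P : Γ × ℕ → Prop} (hf : PolyTime f) (hP : PolyDec P) :
    PolyDec fun γ => P (γ, f γ) :=
  PolyTime.letNat hf hP

/-- Primitive recursion with a polynomially bounded result. -/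
theorem PolyTime.rec {b i : Γ → ℕ} {g : (Γ × ℕ) × ℕ → ℕ} {B : Γ → ℕ} (hb : PolyTime b)
    (hi : PolyTime i) (hg : PolyTime g) (hB : PolyBdd B)
    (h : ∀ γ, ∀ j ≤ b γ, Nat.rec (motive := fun _ => ℕ) (i γ) (fun j x => g ((γ, j), x)) j ≤ B γ) :
    PolyTime fun γ => Nat.rec (motive := fun _ => ℕ) (i γ) (fun j x => g ((γ, j), x)) (b γ) := by
  refine ⟨hB.mono fun γ => h γ _ le_rfl, ?_⟩
  obtain ⟨hb', T₁, hT₁, hb⟩ := hb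
  obtain ⟨-, T₂, hT₂, hi⟩ := hi
  obtain ⟨-, T₃, hT₃, hg⟩ := hg
  -- The time of a round depends on the accumulator and on the round number; the bounds `B` and `b`
  -- eliminate them one after the other.
  obtain ⟨T₄, hT₄, hT₃₄⟩ := hT₃.exists_bound hB.fst
  obtain ⟨T₅, hT₅, hT₄₅⟩ := hT₄.exists_bound hb'
  refine ⟨_, (hT₁.add (hT₂.add (PolyBdd.const 2))).add
    ((hb'.mul ((hT₅.add (.const 2)).add (.const 1))).add (.const 1)), fun ℓ r a hℓ => ?_⟩
  -- Register r holds the accumulator, r + 1 the round number, r + 2 the number of rounds; the step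
  -- function works from r + 3 on.
  obtain ⟨p₁, hp₁⟩ := hb ℓ (r + 2) a (Ctx.below_mono hℓ (by omega) le_rfl)
  obtain ⟨p₂, hp₂⟩ := hi ℓ (r + 3) a (Ctx.below_mono hℓ (by omega) le_rfl)
  obtain ⟨p₃, hp₃⟩ := hg ((ℓ, r + 1), r) (r + 3) a
    ⟨⟨Ctx.below_mono hℓ (by omega) le_rfl, by simp⟩, by simp⟩
  refine ⟨.seq (.seq p₁ (.seq p₂ (.seq (.set r (.reg (r + 3))) (.set (r + 1) (.const 0)))))
    (.loop (.sub (.reg (r + 2)) (.reg (r + 1))) (.seq p₃ (.seq (.set r (.reg (r + 3)))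
      (.set (r + 1) (.add (.reg (r + 1)) (.const 1)))))), fun γ s hs => ?_⟩
  let R : ℕ → ℕ := Nat.rec (motive := fun _ => ℕ) (i γ) (fun j x => g ((γ, j), x))
  let I : ℕ → State → Prop := fun j s' => s'.reg r = R j ∧ s'.reg (r + 1) = j ∧
    s'.reg (r + 2) = b γ ∧ Agree r a s s'
  refine Runs.seq (Runs.seq ((hp₁ γ s hs).mono le_rfl ?_))
  rintro s₁ ⟨h1, h2⟩
  have h2 := h2.mono (show r ≤ r + 2 by omega) (le_refl a)
  refine Runs.seq ((hp₂ γ s₁ (Ctx.rep_congr hℓ hs h2)).mono le_rfl ?_)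
  rintro s₂ ⟨h3, h4⟩
  have h5 := h2.trans (h4.mono (show r ≤ r + 3 by omega) (le_refl a))
  refine Runs.seq (T₁ := 1) (T₂ := 1) (Runs.set (Runs.set ?_))
  refine (Runs.loop I (b γ) (T := T₅ γ + 2) ?_ ?_ ?_).mono le_rfl ?_
  · rintro j hj s' ⟨i1, i2, i3, i4⟩
    refine ⟨by simp [Expr.eval, i2, i3]; omega, Runs.seq ((hp₃ ((γ, j), R j) s' ?_).mono ?_ ?_)⟩
    · exact ⟨⟨Ctx.rep_congr hℓ hs i4, i2⟩, i1⟩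
    · exact (hT₃₄ (γ, j) _ (h γ j hj.le)).trans (hT₄₅ γ j hj.le)
    · rintro s'' ⟨i5, i6⟩
      refine Runs.seq (T₁ := 1) (T₂ := 1) (Runs.set (Runs.set ?_))
      refine ⟨?_, ?_, ?_, ?_⟩
      · simpa [Expr.eval] using i5
      · simpa [Expr.eval] using (i6.1 (r + 1) (by omega)).trans i2
      · simpa [Expr.eval] using (i6.1 (r + 2) (by omega)).trans i3
      · exact ((i4.trans (i6.mono (by omega) le_rfl)).setReg le_rfl).setReg (by omega)
  · rintro s' ⟨i1, i2, i3, i4⟩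
    simp [Expr.eval, i2, i3]
  · refine ⟨?_, ?_, ?_, ?_⟩
    · simpa [Expr.eval, R] using h3
    · simp [Expr.eval]
    · simpa [Expr.eval] using (h4.1 (r + 2) (by omega)).trans h1
    · exact (h5.setReg le_rfl).setReg (by omega)
  · rintro s' ⟨i1, i2, i3, i4⟩
    exact ⟨i1, i4⟩

/-- The sets of numbers `A γ` are stored in an array. -/
def IsStored (A : Γ → ℕ → Prop) : Prop :=
  ∀ (ℓ : Ctx.Layout Γ), ∃ b, ∀ γ s, Ctx.Rep ℓ s γ → ∀ i, s.arr b i ≠ 0 ↔ A γ i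

theorem IsStored.snd : IsStored fun γ : Γ × (ℕ → Prop) => γ.2 :=
  fun ℓ => ⟨ℓ.2, fun _ _ h => h.2⟩

theorem IsStored.fst {A : Γ → ℕ → Prop} (hA : IsStored A) :
    IsStored fun γ : Γ × ℕ => A γ.1 := fun ℓ => by
  obtain ⟨b, hb⟩ := hA ℓ.1
  exact ⟨b, fun γ s h => hb γ.1 s h.1⟩

theorem IsStored.fst' {A : Γ → ℕ → Prop} (hA : IsStored A) :
    IsStored fun γ : Γ × (ℕ → Prop) => A γ.1 := fun ℓ => by
  obtain ⟨b, hb⟩ := hA ℓ.1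
  exact ⟨b, fun γ s h => hb γ.1 s h.1⟩

theorem PolyDec.lookup {A : Γ → ℕ → Prop} {f : Γ → ℕ} (hA : IsStored A) (hf : PolyTime f) :
    PolyDec fun γ => A γ (f γ) := by
  obtain ⟨-, T, hT, hf⟩ := hf
  refine ⟨(PolyBdd.const 1).mono fun γ => by split_ifs <;> simp, _, hT.add (.const 2),
    fun ℓ r a hℓ => ?_⟩
  obtain ⟨p, hp⟩ := hf ℓ r a hℓ
  obtain ⟨b, hb⟩ := hA ℓ
  refine ⟨.seq p (.ite (.get b (.reg r)) (.set r (.const 1)) (.set r (.const 0))), fun γ s hs =>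
    Runs.seq ((hp γ s hs).mono le_rfl ?_)⟩
  rintro s₁ ⟨h1, h2⟩
  have h3 := hb γ s₁ (Ctx.rep_congr hℓ hs h2)
  refine Runs.ite (T := 1) (fun h => Runs.set ?_) fun h => Runs.set ?_
  · have : A γ (f γ) := (h3 _).1 (by simpa [Expr.eval, h1] using h)
    exact ⟨by simp [Expr.eval, this], h2.setReg le_rfl⟩
  · have : ¬ A γ (f γ) := fun hn => (h3 _).2 hn (by simpa [Expr.eval, h1] using h)
    exact ⟨by simp [Expr.eval, this], h2.setReg le_rfl⟩

/-- Course-of-values recursion: a table of the values of `h γ` is filled in increasing order, and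
the computation of each entry may use all earlier ones. -/
theorem PolyDec.table {h : Γ → ℕ → Prop} {F : (Γ × (ℕ → Prop)) × ℕ → Prop} {b : Γ → ℕ}
    (hF : PolyDec F) (hb : PolyTime b)
    (hh : ∀ γ A j, (∀ i < j, A i ↔ h γ i) → (F ((γ, A), j) ↔ h γ j)) :
    PolyDec fun γ => h γ (b γ) := by
  classical
  obtain ⟨-, T₁, hT₁, hF⟩ := hF
  obtain ⟨hb', T₂, hT₂, hb⟩ := hb
  obtain ⟨C, hC⟩ := hT₁
  have hT₃ : PolyBdd fun γ : Γ => (Ctx.size γ + b γ + 2) ^ C :=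
    ((PolyBdd.size.add hb').add (.const 2)).pow C
  refine ⟨(PolyBdd.const 1).mono fun γ => by split_ifs <;> simp, _,
    (hT₂.add (.const 1)).add ((((hb'.add (.const 1)).mul
      ((hT₃.add (.const 2)).add (.const 1))).add (.const 1)).add (.const 2)), fun ℓ r a hℓ => ?_⟩
  obtain ⟨p₁, hp₁⟩ := hb ℓ (r + 1) a (Ctx.below_mono hℓ (by omega) le_rfl)
  obtain ⟨p₂, hp₂⟩ := hF ((ℓ, a), r) (r + 2) (a + 1)
    ⟨⟨Ctx.below_mono hℓ (by omega) (by omega), by simp⟩, by simp⟩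
  refine ⟨.seq (.seq p₁ (.set r (.const 0))) (.seq
    -- There are b γ + 1 rounds, so that entry b γ, the one that is asked for, is filled as well.
    (.loop (.sub (.add (.reg (r + 1)) (.const 1)) (.reg r)) (.seq p₂ (.seq
      (.put a (.reg r) (.reg (r + 2))) (.set r (.add (.reg r) (.const 1))))))
    (.ite (.get a (.reg (r + 1))) (.set r (.const 1)) (.set r (.const 0)))), fun γ s hs => ?_⟩
  let I : ℕ → State → Prop := fun j s' => (∀ i < j, s'.arr a i ≠ 0 ↔ h γ i) ∧ s'.reg r = j ∧
    s'.reg (r + 1) = b γ ∧ Agree r a s s'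
  refine Runs.seq (Runs.seq ((hp₁ γ s hs).mono le_rfl ?_))
  rintro s₁ ⟨h1, h2⟩
  have h2 := h2.mono (show r ≤ r + 1 by omega) (le_refl a)
  refine Runs.set (Runs.seq ?_)
  refine (Runs.loop I (b γ + 1) (T := (Ctx.size γ + b γ + 2) ^ C + 2) ?_ ?_ ?_).mono le_rfl ?_
  · rintro j hj s' ⟨i1, i2, i3, i4⟩
    -- `F` is run on the current contents of the whole array. Cells from j on may hold anything;
    -- `hh` only asks for agreement below j.
    refine ⟨by simp [Expr.eval, i2, i3]; omega, Runs.seq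
      ((hp₂ ((γ, fun i => s'.arr a i ≠ 0), j) s' ?_).mono ?_ ?_)⟩
    · exact ⟨⟨Ctx.rep_congr hℓ hs i4, fun i => Iff.rfl⟩, i2⟩
    · exact (hC _).trans (Nat.pow_le_pow_left (by simp; omega) _)
    · rintro s'' ⟨i5, i6⟩
      have e1 : s''.reg r = j := (i6.1 r (by omega)).trans i2
      have e2 : s''.arr a = s'.arr a := i6.2 a (by omega)
      refine Runs.seq (T₁ := 1) (T₂ := 1) (Runs.put (Runs.set ?_))
      refine ⟨fun i hi => ?_, ?_, ?_, ?_⟩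
      · simp only [State.setReg_arr, State.setArr_arr, Expr.eval, e1, e2, i5]
        rcases eq_or_ne i j with rfl | hne
        · simp [hh γ (fun i => s'.arr a i ≠ 0) i i1]
        · simpa [hne] using i1 i (by omega)
      · simp [Expr.eval, e1]
      · simpa [Expr.eval] using (i6.1 (r + 1) (by omega)).trans i3
      · exact ((i4.trans (i6.mono (by omega) (by omega))).setArr le_rfl).setReg le_rfl
  · rintro s' ⟨i1, i2, i3, i4⟩
    simp [Expr.eval, i2, i3]
  · refine ⟨by simp, ?_, ?_, ?_⟩
    · simp [Expr.eval]
    · simpa [Expr.eval] using h1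
    · exact h2.setReg le_rfl
  · rintro s' ⟨i1, i2, i3, i4⟩
    have i5 := i1 (b γ) (by omega)
    refine Runs.ite (T := 1) (fun h' => Runs.set ?_) fun h' => Runs.set ?_
    · have : h γ (b γ) := i5.1 (by simpa [Expr.eval, i3] using h')
      exact ⟨by simp [Expr.eval, this], i4.setReg le_rfl⟩
    · have : ¬ h γ (b γ) := fun hn => i5.2 hn (by simpa [Expr.eval, i3] using h')
      exact ⟨by simp [Expr.eval, this], i4.setReg le_rfl⟩

end RAM

namespace RAM

variable {Γ : Type} [Ctx Γ]

/-! ### Closure properties -/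

theorem PolyDec.ne_zero {f : Γ → ℕ} (hf : PolyTime f) : PolyDec fun γ => f γ ≠ 0 :=
  PolyTime.congr ((PolyTime.const 1).sub ((PolyTime.const 1).sub hf)) fun γ => by
    split_ifs <;> omega

theorem PolyDec.not {P : Γ → Prop} (hP : PolyDec P) : PolyDec fun γ => ¬ P γ :=
  PolyTime.congr ((PolyTime.const 1).sub hP) fun γ => by by_cases h : P γ <;> simp [h]

theorem PolyDec.and {P Q : Γ → Prop} (hP : PolyDec P) (hQ : PolyDec Q) :
    PolyDec fun γ => P γ ∧ Q γ := by
  classical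
  exact PolyTime.congr (PolyTime.ite hP hQ (PolyTime.const 0)) fun γ => by
    by_cases P γ <;> by_cases Q γ <;> simp_all

theorem PolyDec.or {P Q : Γ → Prop} (hP : PolyDec P) (hQ : PolyDec Q) :
    PolyDec fun γ => P γ ∨ Q γ :=
  (hP.not.and hQ.not).not.congr fun γ => by tauto

theorem PolyDec.imp {P Q : Γ → Prop} (hP : PolyDec P) (hQ : PolyDec Q) :
    PolyDec fun γ => P γ → Q γ :=
  (hP.not.or hQ).congr fun γ => by tauto

theorem PolyDec.iff {P Q : Γ → Prop} (hP : PolyDec P) (hQ : PolyDec Q) :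
    PolyDec fun γ => (P γ ↔ Q γ) :=
  ((hP.imp hQ).and (hQ.imp hP)).congr fun γ => by tauto

theorem PolyDec.lt {f g : Γ → ℕ} (hf : PolyTime f) (hg : PolyTime g) :
    PolyDec fun γ => f γ < g γ :=
  (PolyDec.ne_zero (hg.sub hf)).congr fun γ => by omega

theorem PolyDec.le {f g : Γ → ℕ} (hf : PolyTime f) (hg : PolyTime g) :
    PolyDec fun γ => f γ ≤ g γ :=
  (PolyDec.lt hg hf).not.congr fun γ => by omega

theorem PolyDec.eq {f g : Γ → ℕ} (hf : PolyTime f) (hg : PolyTime g) :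
    PolyDec fun γ => f γ = g γ :=
  ((PolyDec.le hf hg).and (PolyDec.le hg hf)).congr fun γ => by omega

/-- Counting is a primitive recursion whose partial results never exceed the bound. Bounded
quantifiers reduce to it: a witness exists iff the count is nonzero. -/
theorem PolyTime.count {P : Γ → ℕ → Prop} [∀ γ, DecidablePred (P γ)] {b : Γ → ℕ} (hb : PolyTime b)
    (hP : PolyDec fun q : Γ × ℕ => P q.1 q.2) : PolyTime fun γ => Nat.count (P γ) (b γ) := by
  have key : ∀ γ j, Nat.rec (motive := fun _ => ℕ) 0
      (fun j x => x + if P γ j then 1 else 0) j = Nat.count (P γ) j := by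
    intro γ j
    induction j with
    | zero => simp
    | succ j ih => rw [Nat.count_succ, ← ih]
  refine PolyTime.congr (PolyTime.rec (i := fun _ => 0)
    (g := fun q => q.2 + if P q.1.1 q.1.2 then 1 else 0) hb (PolyTime.const 0)
    (PolyTime.snd.add ((PolyTime.fst hP).congr fun _ => by congr)) hb.1 fun γ j hj => ?_)
    fun γ => key γ _
  rw [key]
  exact (Nat.count_le _).trans hj

theorem PolyDec.bex {P : Γ → ℕ → Prop} {b : Γ → ℕ} (hb : PolyTime b)
    (hP : PolyDec fun q : Γ × ℕ => P q.1 q.2) : PolyDec fun γ => ∃ y < b γ, P γ y := by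
  classical
  refine (PolyDec.ne_zero (PolyTime.count hb hP)).congr fun γ => ?_
  rw [Nat.count_eq_card_filter_range, Finset.card_ne_zero, Finset.filter_nonempty_iff]
  simp

theorem PolyDec.ball {P : Γ → ℕ → Prop} {b : Γ → ℕ} (hb : PolyTime b)
    (hP : PolyDec fun q : Γ × ℕ => P q.1 q.2) : PolyDec fun γ => ∀ y < b γ, P γ y :=
  (PolyDec.bex (P := fun γ y => ¬ P γ y) hb hP.not).not.congr fun γ => by push Not; rfl

theorem PolyTime.mul {f g : Γ → ℕ} (hf : PolyTime f) (hg : PolyTime g) :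
    PolyTime fun γ => f γ * g γ := by
  have key : ∀ γ j, Nat.rec (motive := fun _ => ℕ) 0 (fun _ x => x + g γ) j = j * g γ := by
    intro γ j
    induction j with
    | zero => simp
    | succ j ih => rw [add_mul, one_mul, ← ih]
  refine PolyTime.congr (PolyTime.rec (i := fun _ => 0) (g := fun q => q.2 + g q.1.1) hf
    (PolyTime.const 0) (PolyTime.snd.add hg.fst.fst) (hf.1.mul hg.1) fun γ j hj => ?_)
    fun γ => key γ _
  rw [key]
  exact Nat.mul_le_mul_right _ hj

/-- The quotient is the number of q < f with (q + 1) g ≤ f. The case g = 0 is separate, because then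
every q would be counted although division by zero gives 0. -/
theorem PolyTime.div {f g : Γ → ℕ} (hf : PolyTime f) (hg : PolyTime g) :
    PolyTime fun γ => f γ / g γ := by
  classical
  refine (PolyTime.ite (PolyDec.ne_zero hg) (PolyTime.count hf (P := fun γ q =>
    (q + 1) * g γ ≤ f γ) (PolyDec.le ((PolyTime.snd.add (.const 1)).mul hg.fst) hf.fst))
    (.const 0)).congr fun γ => ?_
  split_ifs with h
  · rw [Nat.count_eq_card_filter_range]
    have h0 : 0 < g γ := Nat.pos_of_ne_zero h
    trans (Finset.range (f γ / g γ)).card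
    · congr 1
      ext q
      simp only [Finset.mem_filter, Finset.mem_range, ← Nat.le_div_iff_mul_le h0]
      have := Nat.div_le_self (f γ) (g γ)
      omega
    · exact Finset.card_range _
  · simp [not_not.1 h]

theorem PolyTime.mod {f g : Γ → ℕ} (hf : PolyTime f) (hg : PolyTime g) :
    PolyTime fun γ => f γ % g γ :=
  (hf.sub (hg.mul (hf.div hg))).congr fun _ => Nat.mod_eq_sub_mul_div.symm

theorem PolyDec.testBit {f g : Γ → ℕ} (hf : PolyTime f) (hg : PolyTime g) :
    PolyDec fun γ => (f γ).testBit (g γ) = true := by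
  -- Iterated halving avoids computing 2 ^ g, which need not be polynomially bounded; all partial
  -- results stay below f.
  have key : ∀ γ j, Nat.rec (motive := fun _ => ℕ) (f γ) (fun _ x => x / 2) j = f γ / 2 ^ j := by
    intro γ j
    induction j with
    | zero => simp
    | succ j ih => rw [pow_succ, ← Nat.div_div_eq_div_mul, ← ih]
  have h1 : PolyTime fun γ => f γ / 2 ^ g γ := by
    refine (PolyTime.rec (g := fun q => q.2 / 2) hg hf (PolyTime.snd.div (.const 2)) hf.1
      fun _ _ _ => ?_).congr fun γ => key γ _
    rw [key]
    exact Nat.div_le_self _ _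
  exact (PolyDec.eq (h1.mod (.const 2)) (.const 1)).congr fun γ => by
    rw [Nat.testBit_eq_decide_div_mod_eq, decide_eq_true_iff]

/-! ### Partitions of sets of bits -/

/-- The set of bits of `τ` is the disjoint union of the sets of bits of some numbers
`w 0, …, w (n - 1)` such that `Q v (w v)` for all `v`. -/
def BitPartition (Q : ℕ → ℕ → Prop) (n τ : ℕ) : Prop :=
  ∃ w : ℕ → ℕ, (∀ v < n, Q v (w v)) ∧ (∀ i, τ.testBit i ↔ ∃ v < n, (w v).testBit i) ∧
    ∀ u < n, ∀ v < n, ∀ i, (w u).testBit i → (w v).testBit i → u = v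

theorem bitPartition_zero {Q : ℕ → ℕ → Prop} {τ : ℕ} : BitPartition Q 0 τ ↔ τ = 0 := by
  constructor
  · rintro ⟨w, -, h, -⟩
    refine Nat.eq_of_testBit_eq fun i => ?_
    simpa using h i
  · rintro rfl
    exact ⟨fun _ => 0, by simp⟩

/-- The last piece is disjoint from the others, so xor removes it and leaves exactly their union.
This is the recurrence of the dynamic program. -/
theorem bitPartition_succ {Q : ℕ → ℕ → Prop} {n τ : ℕ} : BitPartition Q (n + 1) τ ↔
    ∃ w ρ, (∀ i, τ.testBit i ↔ w.testBit i ∨ ρ.testBit i) ∧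
      (∀ i, ¬ (w.testBit i ∧ ρ.testBit i)) ∧ Q n w ∧ BitPartition Q n ρ := by
  constructor
  · rintro ⟨w, h1, h2, h3⟩
    have hρ : ∀ i, (τ ^^^ w n).testBit i ↔ ∃ v < n, (w v).testBit i := by
      intro i
      rw [Nat.testBit_xor]
      by_cases hw : (w n).testBit i
      · have : ¬ ∃ v < n, (w v).testBit i := by
          rintro ⟨v, hv, h⟩
          exact absurd (h3 v (by omega) n (by omega) i h hw) (by omega)
        have h4 := (h2 i).2 ⟨n, by omega, hw⟩
        simpa [hw, h4] using this
      · simp only [hw, Bool.xor_false, h2]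
        constructor
        · rintro ⟨v, hv, h⟩
          refine ⟨v, lt_of_le_of_ne (by omega) ?_, h⟩
          rintro rfl
          exact hw h
        · rintro ⟨v, hv, h⟩
          exact ⟨v, by omega, h⟩
    refine ⟨w n, τ ^^^ w n, fun i => ?_, fun i => ?_, h1 n (by omega), w,
      fun v hv => h1 v (by omega), hρ, fun u hu v hv => h3 u (by omega) v (by omega)⟩
    · rw [hρ, h2]
      constructor
      · rintro ⟨v, hv, h⟩
        rcases eq_or_lt_of_le (Nat.le_of_lt_succ hv) with rfl | hv'
        · exact Or.inl h
        · exact Or.inr ⟨v, hv', h⟩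
      · rintro (h | ⟨v, hv, h⟩)
        · exact ⟨n, by omega, h⟩
        · exact ⟨v, by omega, h⟩
    · rw [hρ]
      rintro ⟨h, v, hv, h'⟩
      exact absurd (h3 v (by omega) n (by omega) i h' h) (by omega)
  · rintro ⟨x, ρ, h1, h2, h3, w, h4, h5, h6⟩
    refine ⟨fun v => if v = n then x else w v, fun v hv => ?_, fun i => ?_,
      fun u hu v hv i => ?_⟩
    · dsimp only
      split_ifs with h
      · rwa [h]
      · exact h4 v (by omega)
    · rw [h1, h5]
      constructor
      · rintro (h | ⟨v, hv, h⟩)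
        · exact ⟨n, by omega, by simpa using h⟩
        · exact ⟨v, by omega, by simpa [hv.ne] using h⟩
      · rintro ⟨v, hv, h⟩
        dsimp only at h
        split_ifs at h with hn
        · exact Or.inl h
        · exact Or.inr ⟨v, by omega, h⟩
    · have h7 := fun v hv (h : (w v).testBit i) => (h5 i).2 ⟨v, hv, h⟩
      have h8 := h2 i
      dsimp only
      split_ifs with hu' hv' hv'
      · intros; omega
      · intro h h'
        exact absurd ⟨h, h7 v (by omega) h'⟩ h8
      · intro h h'
        exact absurd ⟨h', h7 u (by omega) h⟩ h8
      · exact h6 u (by omega) v (by omega) i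

/-- Every piece of a partition of τ is therefore at most τ, which bounds the search for pieces. -/
theorem le_of_testBit_imp {x y : ℕ} (h : ∀ i, x.testBit i → y.testBit i) : x ≤ y := by
  have : y &&& x = x := Nat.eq_of_testBit_eq fun i => by
    rw [Nat.testBit_and]
    cases hx : x.testBit i
    · simp
    · simp [h i hx]
  exact this ▸ Nat.and_le_left

/-- Comparing bits below τ + 1 thus suffices for numbers up to τ. -/
theorem lt_of_testBit {x i : ℕ} (h : x.testBit i) : i < x := by
  by_contra hx
  rw [Nat.testBit_lt_two_pow ((not_lt.1 hx).trans_lt Nat.lt_two_pow_self)] at h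
  exact Bool.false_ne_true h

/-- Dynamic programming over pairs (v, ρ) with ρ ≤ τ, stored at address v (τ + 1) + ρ: can the first
v pieces make up ρ? Each entry tries all splittings of ρ and looks up a pair with smaller v, hence a
smaller address. -/
theorem PolyDec.bitPartition {Q : Γ → ℕ → ℕ → Prop} {n τ : Γ → ℕ} (hn : PolyTime n)
    (hτ : PolyTime τ) (hQ : PolyDec fun q : (Γ × ℕ) × ℕ => Q q.1.1 q.1.2 q.2) :
    PolyDec fun γ => BitPartition (Q γ) (n γ) (τ γ) := by
  let h : Γ → ℕ → Prop := fun γ j => BitPartition (Q γ) (j / (τ γ + 1)) (j % (τ γ + 1))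
  let F : (Γ × (ℕ → Prop)) × ℕ → Prop := fun q =>
    (q.2 / (τ q.1.1 + 1) = 0 ∧ q.2 % (τ q.1.1 + 1) = 0) ∨
    (q.2 / (τ q.1.1 + 1) ≠ 0 ∧ ∃ w < τ q.1.1 + 1, ∃ ρ < τ q.1.1 + 1,
      (∀ i < τ q.1.1 + 1, (q.2 % (τ q.1.1 + 1)).testBit i ↔ w.testBit i ∨ ρ.testBit i) ∧
      (∀ i < τ q.1.1 + 1, ¬ (w.testBit i ∧ ρ.testBit i)) ∧
      Q q.1.1 (q.2 / (τ q.1.1 + 1) - 1) w ∧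
      q.1.2 ((q.2 / (τ q.1.1 + 1) - 1) * (τ q.1.1 + 1) + ρ))
  have hF : PolyDec F := by
    have hW : PolyTime fun q : (Γ × (ℕ → Prop)) × ℕ => τ q.1.1 + 1 := hτ.fst'.fst.add (.const 1)
    have hd : PolyTime fun q : (Γ × (ℕ → Prop)) × ℕ => q.2 / (τ q.1.1 + 1) := PolyTime.snd.div hW
    have hm : PolyTime fun q : (Γ × (ℕ → Prop)) × ℕ => q.2 % (τ q.1.1 + 1) := PolyTime.snd.mod hW
    have hQ' : PolyDec fun q : ((Γ × (ℕ → Prop)) × ℕ) × ℕ =>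
        Q q.1.1.1 (q.1.2 / (τ q.1.1.1 + 1) - 1) q.2 := by
      -- The decider of `Q` expects its two numbers directly on top of `Γ`. Permuting the layout and
      -- skipping the entries in between adapts it without further computation; `letNat` then
      -- supplies the index of the last piece.
      obtain ⟨hB, T, hT, h⟩ := hQ
      let Q'' : (((Γ × (ℕ → Prop)) × ℕ) × ℕ) × ℕ → Prop := fun q => Q q.1.1.1.1 q.2 q.1.2
      have hQ'' : PolyDec Q'' := by
        refine ⟨(PolyBdd.const 1).mono fun γ => by split_ifs <;> simp,
          fun q => (Ctx.size q + 2) ^ hT.choose,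
          (PolyBdd.size.add (.const 2)).pow _, fun ℓ r a hℓ => ?_⟩
        obtain ⟨p, hp⟩ := h ((ℓ.1.1.1.1, ℓ.2), ℓ.1.2) r a
          ⟨⟨hℓ.1.1.1.1, hℓ.2⟩, hℓ.1.2⟩
        refine ⟨p, fun γ s hs => (hp ((γ.1.1.1.1, γ.2), γ.1.2) s
          ⟨⟨hs.1.1.1.1, hs.2⟩, hs.1.2⟩).mono ((hT.choose_spec _).trans ?_) fun _ h => h⟩
        exact Nat.pow_le_pow_left (by simp; omega) _
      exact PolyDec.letNat (hd.fst.sub (.const 1)) hQ''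
    refine ((PolyDec.eq hd (.const 0)).and (PolyDec.eq hm (.const 0))).or
      ((PolyDec.ne_zero hd).and (.bex hW (.bex hW.fst (.and
        (.ball hW.fst.fst (.iff (.testBit hm.fst.fst.fst .snd)
          (.or (.testBit (PolyTime.snd.fst.fst) .snd) (.testBit (PolyTime.snd.fst) .snd))))
        (.and (.ball hW.fst.fst (.not (.and (.testBit (PolyTime.snd.fst.fst) .snd)
          (.testBit (PolyTime.snd.fst) .snd))))
        (.and hQ'.fst (.lookup IsStored.snd.fst.fst.fst
          (((hd.fst.fst.sub (.const 1)).mul hW.fst.fst).add .snd))))))))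
  refine (PolyDec.table (h := h) hF ((hn.mul (hτ.add (.const 1))).add hτ)
    fun γ A j hA => ?_).congr fun γ => ?_
  · simp only [F, h]
    generalize hW : τ γ + 1 = W at *
    have hW0 : 0 < W := by omega
    have hr : j % W < W := Nat.mod_lt _ hW0
    rcases hv : j / W with _ | v
    · simp [bitPartition_zero]
    · rw [bitPartition_succ]
      have hj : j = (v + 1) * W + j % W := by rw [← hv]; exact (Nat.div_add_mod' j W).symm
      have hA' : ∀ ρ < W, A (v * W + ρ) ↔ BitPartition (Q γ) v ρ := by
        intro ρ hρ
        rw [hA _ (by rw [hj, add_mul]; omega)]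
        simp only [h, hW]
        rw [Nat.mul_add_mod', Nat.mod_eq_of_lt hρ, mul_comm, Nat.mul_add_div hW0,
          Nat.div_eq_of_lt hρ, add_zero]
      simp only [Nat.add_eq_zero_iff, one_ne_zero, and_false, false_and, false_or, ne_eq,
        not_false_eq_true, true_and, Nat.add_sub_cancel]
      constructor
      · rintro ⟨w, hw, ρ, hρ, h1, h2, h3, h4⟩
        have hlt : ∀ {x i : ℕ}, x < W → x.testBit i → i < W :=
          fun hx hi => (lt_of_testBit hi).trans hx
        refine ⟨w, ρ, fun i => ?_, fun i hi => h2 i (hlt hw hi.1) hi, h3, (hA' ρ hρ).1 h4⟩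
        by_cases hi : i < W
        · exact h1 i hi
        · have := fun h => hi (hlt hr h)
          have := fun h => hi (hlt hw h)
          have := fun h => hi (hlt hρ h)
          tauto
      · rintro ⟨w, ρ, h1, h2, h3, h4⟩
        have hw : w < W := (le_of_testBit_imp fun i hi => (h1 i).2 (Or.inl hi)).trans_lt hr
        have hρ : ρ < W := (le_of_testBit_imp fun i hi => (h1 i).2 (Or.inr hi)).trans_lt hr
        exact ⟨w, hw, ρ, hρ, fun i _ => h1 i, fun i _ => h2 i, h3, (hA' ρ hρ).2 h4⟩
  · simp only [h]
    rw [mul_comm, Nat.mul_add_mod, Nat.mod_eq_of_lt (by omega), Nat.mul_add_div (by omega),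
      Nat.div_eq_of_lt (by omega), add_zero]

end RAM

/-! ### The decision procedure

Vertices are the numbers below `n`, and the set `A` of numbers encodes the adjacency matrix. -/

namespace BColoring

/-- Adjacency of `i` and `j`. -/
def Edge (A : ℕ → Prop) (n i j : ℕ) : Prop := A (i * n + j)

/-- `a`, `b`, `c` induce an edge `b c` and an isolated vertex `a`. -/
def Obstruct (A : ℕ → Prop) (n a b c : ℕ) : Prop :=
  ¬ Edge A n a b ∧ ¬ Edge A n a c ∧ Edge A n b c

/-- The vertex `v` belongs to the triple encoded by `t`. -/
def OnTriple (n t v : ℕ) : Prop := v = t / (n * n) ∨ v = t / n % n ∨ v = t % n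

/-- The triple `t` is an obstruction that is disjoint from all obstructions selected earlier. -/
def Selected (A : ℕ → Prop) (n t : ℕ) : Prop :=
  Obstruct A n (t / (n * n)) (t / n % n) (t % n) ∧
    ∀ t' < t, Selected A n t' → ∀ v < n, ¬ (OnTriple n t v ∧ OnTriple n t' v)
termination_by t

/-- The vertices of the selected obstructions. -/
def Marked (A : ℕ → Prop) (n v : ℕ) : Prop := ∃ t < n * n * n, Selected A n t ∧ OnTriple n t v

open Classical in
/-- The number of marked vertices before `v`. -/
noncomputable def rank (A : ℕ → Prop) (n v : ℕ) : ℕ := Nat.count (Marked A n) v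

/-- The number of marked vertices. -/
noncomputable def numMarked (A : ℕ → Prop) (n : ℕ) : ℕ := rank A n n

/-- Entry `(a, d)` of the relation encoded by the number `σ`. -/
def Bit (A : ℕ → Prop) (n σ a d : ℕ) : Prop := σ.testBit (a * (numMarked A n + 1) + d) = true

/-- `v` is the first vertex of its part. -/
def IsRep (A : ℕ → Prop) (n v : ℕ) : Prop := ¬ Marked A n v ∧ ∀ u < v, Marked A n u ∨ Edge A n u v

/-- `v` is an unmarked vertex in the part of `r`. -/
def InPart (A : ℕ → Prop) (n r v : ℕ) : Prop := ¬ Marked A n v ∧ ¬ Edge A n r v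

/-- `v` has a marked neighbor with color `d`. -/
def SeenMarked (A : ℕ → Prop) (n col v d : ℕ) : Prop :=
  ∃ x < n, Marked A n x ∧ Edge A n x v ∧ Bit A n col (rank A n x) d

/-- The unmarked vertex `v` may receive the color `c`. -/
def Allowed (A : ℕ → Prop) (n col U lam v c : ℕ) : Prop :=
  Bit A n lam (numMarked A n) c ∧
    (c < numMarked A n → U.testBit c = true ∧ ¬ SeenMarked A n col v c)

/-- The unmarked vertex `v` with color `c` is a b-vertex. -/
def SeesAll (A : ℕ → Prop) (n col U τ lam v c : ℕ) : Prop :=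
  (c < numMarked A n → ¬ Bit A n lam (numMarked A n) (numMarked A n)) ∧
    ∀ d < numMarked A n, U.testBit d = true → d ≠ c → SeenMarked A n col v d ∨
      (Bit A n τ (numMarked A n) d ∧ ¬ Bit A n lam (numMarked A n) d)

/-- The vertex `v` can be colored such that it has all the tasks in `w`. -/
def VertexServes (A : ℕ → Prop) (n col U τ lam r v w : ℕ) : Prop :=
  (¬ InPart A n r v ∧ w = 0) ∨ (InPart A n r v ∧ ∃ c < numMarked A n + 1,
    Allowed A n col U lam v c ∧ ∀ d < numMarked A n + 1,
      (∀ x < n, Marked A n x → Bit A n w (rank A n x) d → c = d ∧ Edge A n x v) ∧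
      (Bit A n w (numMarked A n) d → c = d) ∧
      (Bit A n w (numMarked A n + 1) d → c = d ∧ SeesAll A n col U τ lam v c))

/-- A part with a private color. -/
def PrivatePart (A : ℕ → Prop) (n Bs lam μ : ℕ) : Prop :=
  Bit A n lam (numMarked A n) (numMarked A n) ∧
  Bit A n lam (numMarked A n + 1) (numMarked A n) ∧
  (∀ x < n, Marked A n x → Bs.testBit (rank A n x) = true →
    Bit A n lam (rank A n x) (numMarked A n)) ∧
  ∀ d < numMarked A n, ¬ Bit A n μ (numMarked A n + 2) d

/-- A part without a private color; it owns one token. -/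
def TokenPart (A : ℕ → Prop) (n lam μ : ℕ) : Prop :=
  ¬ Bit A n lam (numMarked A n) (numMarked A n) ∧
  ∃ d < numMarked A n, Bit A n μ (numMarked A n + 2) d ∧
    ∀ d' < numMarked A n, Bit A n μ (numMarked A n + 2) d' → d' = d

/-- The part represented by `r` can be colored such that it has exactly the tasks in `μ`. -/
def PartServes (A : ℕ → Prop) (n M col U Bs τ r μ : ℕ) : Prop :=
  (¬ IsRep A n r ∧ μ = 0) ∨ (IsRep A n r ∧ ∃ lam < M,
    RAM.BitPartition (VertexServes A n col U τ lam r) n lam ∧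
    (∀ a < numMarked A n + 2, ∀ d < numMarked A n, Bit A n μ a d ↔ Bit A n lam a d) ∧
    (PrivatePart A n Bs lam μ ∨ TokenPart A n lam μ))

/-- The marked vertices are properly colored by `col` with colors from `U`. -/
def ColorsMarked (A : ℕ → Prop) (n col U : ℕ) : Prop :=
  (∀ x < n, Marked A n x → ∃ d < numMarked A n, Bit A n col (rank A n x) d ∧
    U.testBit d = true ∧ ∀ d' < numMarked A n, Bit A n col (rank A n x) d' → d' = d) ∧
  ∀ x < n, ∀ y < n, Marked A n x → Marked A n y → Edge A n x y →
    ∀ d < numMarked A n, ¬ (Bit A n col (rank A n x) d ∧ Bit A n col (rank A n y) d)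

/-- Every color in `U` has a b-vertex, provided that the tasks in `τ` are fulfilled. -/
def HasBVertices (A : ℕ → Prop) (n col U Bs τ : ℕ) : Prop :=
  (∀ d < numMarked A n, U.testBit d = true → Bit A n τ (numMarked A n + 1) d ∨
    ∃ x < n, Marked A n x ∧ Bs.testBit (rank A n x) = true ∧ Bit A n col (rank A n x) d) ∧
  ∀ x < n, Marked A n x → Bs.testBit (rank A n x) = true → ∀ d < numMarked A n,
    U.testBit d = true → Bit A n col (rank A n x) d ∨ SeenMarked A n col x d ∨
      Bit A n τ (rank A n x) d

open Classical in
/-- The number of colors is `k`. -/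
def HasNumColors (A : ℕ → Prop) (n k U τ : ℕ) : Prop :=
  Nat.count (fun d => U.testBit d = true) (numMarked A n) + Nat.count (IsRep A n) n =
    k + Nat.count (Bit A n τ (numMarked A n + 2)) (numMarked A n)

/-- The search for a `k`-b-coloring, encoded by numbers below `M`. -/
def HasCertificate (A : ℕ → Prop) (n k M : ℕ) : Prop :=
  ∃ col < M, ∃ U < M, ∃ Bs < M, ∃ τ < M, ColorsMarked A n col U ∧ HasBVertices A n col U Bs τ ∧
    HasNumColors A n k U τ ∧ RAM.BitPartition (PartServes A n M col U Bs τ) n τ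

end BColoring

namespace RAM

open BColoring

/-! ### Polynomial-time decidability of the certificate predicates. -/

variable {Γ : Type} [Ctx Γ] {A : Γ → ℕ → Prop} {n k M col U Bs τ lam μ r v w c σ a d t i j : Γ → ℕ}

theorem PolyDec.edge (hA : IsStored A) (hn : PolyTime n) (hi : PolyTime i) (hj : PolyTime j) :
    PolyDec fun γ => Edge (A γ) (n γ) (i γ) (j γ) :=
  PolyDec.lookup (A := A) hA ((hi.mul hn).add hj)

theorem PolyDec.obstruct (hA : IsStored A) (hn : PolyTime n) (hi : PolyTime i) (hj : PolyTime j)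
    (hv : PolyTime v) : PolyDec fun γ => Obstruct (A γ) (n γ) (i γ) (j γ) (v γ) :=
  .and (.not (.edge hA hn hi hj)) (.and (.not (.edge hA hn hi hv)) (.edge hA hn hj hv))

theorem PolyDec.onTriple (hn : PolyTime n) (ht : PolyTime t) (hv : PolyTime v) :
    PolyDec fun γ => OnTriple (n γ) (t γ) (v γ) :=
  .or (.eq hv (ht.div (hn.mul hn))) (.or (.eq hv ((ht.div hn).mod hn)) (.eq hv (ht.mod hn)))

/-- The greedy choice consults only earlier selections, so it is a course-of-values recursion. -/
theorem PolyDec.selected (hA : IsStored A) (hn : PolyTime n) (ht : PolyTime t) :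
    PolyDec fun γ => Selected (A γ) (n γ) (t γ) := by
  refine PolyDec.table (h := fun γ j => Selected (A γ) (n γ) j)
    (F := fun q => Obstruct (A q.1.1) (n q.1.1) (q.2 / (n q.1.1 * n q.1.1))
      (q.2 / n q.1.1 % n q.1.1) (q.2 % n q.1.1) ∧ ∀ t' < q.2, q.1.2 t' →
        ∀ v < n q.1.1, ¬ (OnTriple (n q.1.1) q.2 v ∧ OnTriple (n q.1.1) t' v)) ?_ ht ?_
  · have hn' := hn.fst'.fst
    refine .and (.obstruct hA.fst'.fst hn' (PolyTime.snd.div (hn'.mul hn'))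
      ((PolyTime.snd.div hn').mod hn') (PolyTime.snd.mod hn')) (.ball .snd (.imp
      (.lookup IsStored.snd.fst.fst .snd) (.ball hn'.fst (.not (.and
      (.onTriple hn'.fst.fst PolyTime.snd.fst.fst .snd)
      (.onTriple hn'.fst.fst PolyTime.snd.fst .snd))))))
  · intro γ B j hB
    rw [Selected]
    refine and_congr Iff.rfl (forall_congr' fun t' => forall_congr' fun h => ?_)
    exact imp_congr (hB t' h) Iff.rfl

theorem PolyDec.marked (hA : IsStored A) (hn : PolyTime n) (hv : PolyTime v) :
    PolyDec fun γ => Marked (A γ) (n γ) (v γ) :=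
  .bex ((hn.mul hn).mul hn) (.and (.selected hA.fst hn.fst .snd) (.onTriple hn.fst .snd hv.fst))

open Classical in
theorem PolyTime.rank (hA : IsStored A) (hn : PolyTime n) (hv : PolyTime v) :
    PolyTime fun γ => rank (A γ) (n γ) (v γ) :=
  .count hv (.marked hA.fst hn.fst .snd)

theorem PolyTime.numMarked (hA : IsStored A) (hn : PolyTime n) :
    PolyTime fun γ => numMarked (A γ) (n γ) :=
  .rank hA hn hn

theorem PolyDec.bit (hA : IsStored A) (hn : PolyTime n) (hσ : PolyTime σ) (ha : PolyTime a)
    (hd : PolyTime d) : PolyDec fun γ => Bit (A γ) (n γ) (σ γ) (a γ) (d γ) :=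
  .testBit hσ ((ha.mul ((PolyTime.numMarked hA hn).add (.const 1))).add hd)

theorem PolyDec.isRep (hA : IsStored A) (hn : PolyTime n) (hv : PolyTime v) :
    PolyDec fun γ => IsRep (A γ) (n γ) (v γ) :=
  .and (.not (.marked hA hn hv)) (.ball hv (.or (.marked hA.fst hn.fst .snd)
    (.edge hA.fst hn.fst .snd hv.fst)))

theorem PolyDec.inPart (hA : IsStored A) (hn : PolyTime n) (hr : PolyTime r) (hv : PolyTime v) :
    PolyDec fun γ => InPart (A γ) (n γ) (r γ) (v γ) :=
  .and (.not (.marked hA hn hv)) (.not (.edge hA hn hr hv))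

theorem PolyDec.seenMarked (hA : IsStored A) (hn : PolyTime n) (hcol : PolyTime col)
    (hv : PolyTime v) (hd : PolyTime d) :
    PolyDec fun γ => SeenMarked (A γ) (n γ) (col γ) (v γ) (d γ) :=
  .bex hn (.and (.marked hA.fst hn.fst .snd) (.and (.edge hA.fst hn.fst .snd hv.fst)
    (.bit hA.fst hn.fst hcol.fst (.rank hA.fst hn.fst .snd) hd.fst)))

theorem PolyDec.allowed (hA : IsStored A) (hn : PolyTime n) (hcol : PolyTime col)
    (hU : PolyTime U) (hlam : PolyTime lam) (hv : PolyTime v) (hc : PolyTime c) :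
    PolyDec fun γ => Allowed (A γ) (n γ) (col γ) (U γ) (lam γ) (v γ) (c γ) :=
  .and (.bit hA hn hlam (.numMarked hA hn) hc) (.imp (.lt hc (.numMarked hA hn))
    (.and (.testBit hU hc) (.not (.seenMarked hA hn hcol hv hc))))

theorem PolyDec.seesAll (hA : IsStored A) (hn : PolyTime n) (hcol : PolyTime col)
    (hU : PolyTime U) (hτ : PolyTime τ) (hlam : PolyTime lam) (hv : PolyTime v)
    (hc : PolyTime c) :
    PolyDec fun γ => SeesAll (A γ) (n γ) (col γ) (U γ) (τ γ) (lam γ) (v γ) (c γ) := by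
  have hm := PolyTime.numMarked hA hn
  exact .and (.imp (.lt hc hm) (.not (.bit hA hn hlam hm hm))) (.ball hm (.imp
    (.testBit hU.fst .snd) (.imp (.not (.eq .snd hc.fst)) (.or
      (.seenMarked hA.fst hn.fst hcol.fst hv.fst .snd)
      (.and (.bit hA.fst hn.fst hτ.fst hm.fst .snd)
        (.not (.bit hA.fst hn.fst hlam.fst hm.fst .snd)))))))

theorem PolyDec.vertexServes (hA : IsStored A) (hn : PolyTime n) (hcol : PolyTime col)
    (hU : PolyTime U) (hτ : PolyTime τ) (hlam : PolyTime lam) (hr : PolyTime r)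
    (hv : PolyTime v) (hw : PolyTime w) :
    PolyDec fun γ =>
      VertexServes (A γ) (n γ) (col γ) (U γ) (τ γ) (lam γ) (r γ) (v γ) (w γ) := by
  have hm := PolyTime.numMarked hA hn
  have hm1 := hm.add (.const 1)
  refine .or (.and (.not (.inPart hA hn hr hv)) (.eq hw (.const 0)))
    (.and (.inPart hA hn hr hv) (.bex hm1 (.and
      (.allowed hA.fst hn.fst hcol.fst hU.fst hlam.fst hv.fst .snd) (.ball hm1.fst (.and
      (.ball hn.fst.fst (.imp (.marked hA.fst.fst.fst hn.fst.fst.fst .snd) (.imp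
        (.bit hA.fst.fst.fst hn.fst.fst.fst hw.fst.fst.fst
          (.rank hA.fst.fst.fst hn.fst.fst.fst .snd) PolyTime.snd.fst)
        (.and (.eq PolyTime.snd.fst.fst PolyTime.snd.fst)
          (.edge hA.fst.fst.fst hn.fst.fst.fst .snd hv.fst.fst.fst)))))
      (.and (.imp (.bit hA.fst.fst hn.fst.fst hw.fst.fst hm.fst.fst .snd)
          (.eq PolyTime.snd.fst .snd))
        (.imp (.bit hA.fst.fst hn.fst.fst hw.fst.fst hm1.fst.fst .snd)
          (.and (.eq PolyTime.snd.fst .snd) (.seesAll hA.fst.fst hn.fst.fst hcol.fst.fst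
            hU.fst.fst hτ.fst.fst hlam.fst.fst hv.fst.fst PolyTime.snd.fst)))))))))

theorem PolyDec.privatePart (hA : IsStored A) (hn : PolyTime n) (hBs : PolyTime Bs)
    (hlam : PolyTime lam) (hμ : PolyTime μ) :
    PolyDec fun γ => PrivatePart (A γ) (n γ) (Bs γ) (lam γ) (μ γ) := by
  have hm := PolyTime.numMarked hA hn
  exact .and (.bit hA hn hlam hm hm) (.and (.bit hA hn hlam (hm.add (.const 1)) hm) (.and
    (.ball hn (.imp (.marked hA.fst hn.fst .snd) (.imp
      (.testBit hBs.fst (.rank hA.fst hn.fst .snd))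
      (.bit hA.fst hn.fst hlam.fst (.rank hA.fst hn.fst .snd) hm.fst))))
    (.ball hm (.not (.bit hA.fst hn.fst hμ.fst (hm.fst.add (.const 2)) .snd)))))

theorem PolyDec.tokenPart (hA : IsStored A) (hn : PolyTime n) (hlam : PolyTime lam)
    (hμ : PolyTime μ) : PolyDec fun γ => TokenPart (A γ) (n γ) (lam γ) (μ γ) := by
  have hm := PolyTime.numMarked hA hn
  exact .and (.not (.bit hA hn hlam hm hm)) (.bex hm (.and
    (.bit hA.fst hn.fst hμ.fst (hm.fst.add (.const 2)) .snd) (.ball hm.fst (.imp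
      (.bit hA.fst.fst hn.fst.fst hμ.fst.fst (hm.fst.fst.add (.const 2)) .snd)
      (.eq .snd PolyTime.snd.fst)))))

theorem PolyDec.partServes (hA : IsStored A) (hn : PolyTime n) (hM : PolyTime M)
    (hcol : PolyTime col) (hU : PolyTime U) (hBs : PolyTime Bs) (hτ : PolyTime τ)
    (hr : PolyTime r) (hμ : PolyTime μ) :
    PolyDec fun γ =>
      PartServes (A γ) (n γ) (M γ) (col γ) (U γ) (Bs γ) (τ γ) (r γ) (μ γ) := by
  have hm := PolyTime.numMarked hA hn
  refine .or (.and (.not (.isRep hA hn hr)) (.eq hμ (.const 0))) (.and (.isRep hA hn hr)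
    (.bex hM (.and (.bitPartition hn.fst .snd (.vertexServes hA.fst.fst.fst hn.fst.fst.fst
      hcol.fst.fst.fst hU.fst.fst.fst hτ.fst.fst.fst PolyTime.snd.fst.fst hr.fst.fst.fst
      PolyTime.snd.fst .snd)) (.and (.ball (hm.fst.add (.const 2)) (.ball hm.fst.fst (.iff
        (.bit hA.fst.fst.fst hn.fst.fst.fst hμ.fst.fst.fst PolyTime.snd.fst .snd)
        (.bit hA.fst.fst.fst hn.fst.fst.fst PolyTime.snd.fst.fst PolyTime.snd.fst .snd))))
      (.or (.privatePart hA.fst hn.fst hBs.fst .snd hμ.fst)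
        (.tokenPart hA.fst hn.fst .snd hμ.fst))))))

theorem PolyDec.colorsMarked (hA : IsStored A) (hn : PolyTime n) (hcol : PolyTime col)
    (hU : PolyTime U) : PolyDec fun γ => ColorsMarked (A γ) (n γ) (col γ) (U γ) := by
  have hm := PolyTime.numMarked hA hn
  have h2 := PolyTime.rank hA.fst.fst hn.fst.fst PolyTime.snd.fst
  have h3 := PolyTime.rank hA.fst.fst hn.fst.fst PolyTime.snd
  exact .and
    (.ball hn (.imp (.marked hA.fst hn.fst .snd) (.bex hm.fst (.and
      (.bit hA.fst.fst hn.fst.fst hcol.fst.fst h2 .snd) (.and (.testBit hU.fst.fst .snd)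
        (.ball hm.fst.fst (.imp (.bit hA.fst.fst.fst hn.fst.fst.fst hcol.fst.fst.fst h2.fst .snd)
          (.eq .snd PolyTime.snd.fst))))))))
    (.ball hn (.ball hn.fst (.imp (.marked hA.fst.fst hn.fst.fst PolyTime.snd.fst) (.imp
      (.marked hA.fst.fst hn.fst.fst PolyTime.snd) (.imp
      (.edge hA.fst.fst hn.fst.fst PolyTime.snd.fst .snd) (.ball hm.fst.fst (.not (.and
        (.bit hA.fst.fst.fst hn.fst.fst.fst hcol.fst.fst.fst h2.fst .snd)
        (.bit hA.fst.fst.fst hn.fst.fst.fst hcol.fst.fst.fst h3.fst .snd)))))))))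

theorem PolyDec.hasBVertices (hA : IsStored A) (hn : PolyTime n) (hcol : PolyTime col)
    (hU : PolyTime U) (hBs : PolyTime Bs) (hτ : PolyTime τ) :
    PolyDec fun γ => HasBVertices (A γ) (n γ) (col γ) (U γ) (Bs γ) (τ γ) := by
  have hm := PolyTime.numMarked hA hn
  have h1 := PolyTime.rank hA.fst hn.fst PolyTime.snd
  have h2 := PolyTime.rank hA.fst.fst hn.fst.fst PolyTime.snd
  exact .and
    (.ball hm (.imp (.testBit hU.fst .snd) (.or
      (.bit hA.fst hn.fst hτ.fst (hm.fst.add (.const 1)) .snd)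
      (.bex hn.fst (.and (.marked hA.fst.fst hn.fst.fst .snd) (.and (.testBit hBs.fst.fst h2)
        (.bit hA.fst.fst hn.fst.fst hcol.fst.fst h2 PolyTime.snd.fst)))))))
    (.ball hn (.imp (.marked hA.fst hn.fst .snd) (.imp (.testBit hBs.fst h1) (.ball hm.fst
      (.imp (.testBit hU.fst.fst .snd) (.or
        (.bit hA.fst.fst hn.fst.fst hcol.fst.fst h1.fst .snd) (.or
        (.seenMarked hA.fst.fst hn.fst.fst hcol.fst.fst PolyTime.snd.fst .snd)
        (.bit hA.fst.fst hn.fst.fst hτ.fst.fst h1.fst .snd))))))))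

open Classical in
theorem PolyDec.hasNumColors (hA : IsStored A) (hn : PolyTime n) (hk : PolyTime k)
    (hU : PolyTime U) (hτ : PolyTime τ) :
    PolyDec fun γ => HasNumColors (A γ) (n γ) (k γ) (U γ) (τ γ) := by
  have hm := PolyTime.numMarked hA hn
  exact .eq ((PolyTime.count (P := fun γ d => (U γ).testBit d = true) hm
      (.testBit hU.fst .snd)).add (.count (P := fun γ => IsRep (A γ) (n γ)) hn
      (.isRep hA.fst hn.fst .snd)))
    (hk.add (.count (P := fun γ => Bit (A γ) (n γ) (τ γ) (numMarked (A γ) (n γ) + 2)) hm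
      (.bit hA.fst hn.fst hτ.fst (hm.fst.add (.const 2)) .snd)))

/-- The bound `M` is itself a number of the context, so exhaustive search below it counts as
polynomial time. -/
theorem PolyDec.hasCertificate (hA : IsStored A) (hn : PolyTime n) (hk : PolyTime k)
    (hM : PolyTime M) : PolyDec fun γ => HasCertificate (A γ) (n γ) (k γ) (M γ) := by
  have hA := hA.fst.fst.fst.fst
  have hn := hn.fst.fst.fst.fst
  have hcol := ((PolyTime.snd (Γ := Γ)).fst).fst.fst
  have hU := ((PolyTime.snd (Γ := Γ × ℕ)).fst).fst
  have hBs := (PolyTime.snd (Γ := (Γ × ℕ) × ℕ)).fst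
  have hτ := PolyTime.snd (Γ := ((Γ × ℕ) × ℕ) × ℕ)
  exact .bex hM (.bex hM.fst (.bex hM.fst.fst (.bex hM.fst.fst.fst (.and
    (.colorsMarked hA hn hcol hU) (.and (.hasBVertices hA hn hcol hU hBs hτ) (.and
    (.hasNumColors hA hn hk.fst.fst.fst.fst hU hτ) (.bitPartition hn hτ (.partServes hA.fst.fst
      hn.fst.fst hM.fst.fst.fst.fst.fst.fst hcol.fst.fst hU.fst.fst hBs.fst.fst hτ.fst.fst
      PolyTime.snd.fst .snd))))))))

end RAM

namespace BColoring

/-! ### Correctness of the greedy modulator -/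

/-- `A` encodes a loopless symmetric relation on the numbers below `n`. -/
structure IsGraphCode (A : ℕ → Prop) (n : ℕ) : Prop where
  symm : ∀ i < n, ∀ j < n, Edge A n i j → Edge A n j i
  irrefl : ∀ i < n, ¬ Edge A n i i

variable {A : ℕ → Prop} {n : ℕ}

theorem selected_iff {t : ℕ} : Selected A n t ↔ Obstruct A n (t / (n * n)) (t / n % n) (t % n) ∧
    ∀ t' < t, Selected A n t' → ∀ v < n, ¬ (OnTriple n t v ∧ OnTriple n t' v) := by
  rw [Selected]

/-- Maximality of the greedy family: an obstruction is either selected or meets one selected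
earlier, so it contains a marked vertex in both cases. -/
theorem not_obstruct_of_not_marked {a b c : ℕ} (ha : a < n) (hb : b < n) (hc : c < n)
    (ha' : ¬ Marked A n a) (hb' : ¬ Marked A n b) (hc' : ¬ Marked A n c) :
    ¬ Obstruct A n a b c := by
  intro h
  have hn : 0 < n := by omega
  set t := (a * n + b) * n + c with ht
  have h1 : t % n = c := by rw [ht, Nat.mul_add_mod', Nat.mod_eq_of_lt hc]
  have h2 : t / n = a * n + b := by
    rw [ht, mul_comm, Nat.mul_add_div hn, Nat.div_eq_of_lt hc, add_zero]
  have h3 : t / n % n = b := by rw [h2, Nat.mul_add_mod', Nat.mod_eq_of_lt hb]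
  have h4 : t / (n * n) = a := by
    rw [← Nat.div_div_eq_div_mul, h2, mul_comm, Nat.mul_add_div hn, Nat.div_eq_of_lt hb, add_zero]
  have h5 : t < n * n * n := by
    have : a * n + b < n * n := by nlinarith
    nlinarith
  have h6 : ∀ v, OnTriple n t v → ¬ Marked A n v := by
    rintro v (rfl | rfl | rfl)
    · rwa [h4]
    · rwa [h3]
    · rwa [h1]
  have h7 : ¬ Selected A n t := fun hs => h6 a (Or.inl h4.symm) ⟨t, h5, hs, Or.inl h4.symm⟩
  rw [selected_iff, h1, h3, h4, not_and] at h7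
  specialize h7 h
  push Not at h7
  obtain ⟨t', ht', hs, v, -, hv, hv'⟩ := h7
  exact h6 v hv ⟨t', ht'.trans h5, hs, hv'⟩

theorem numMarked_eq_card [DecidablePred (Marked A n)] :
    numMarked A n = ((Finset.range n).filter (Marked A n)).card := by
  rw [numMarked, rank, Nat.count_eq_card_filter_range]
  congr

/-- If every obstruction meets `S`, then the greedy modulator has at most `3 * S.card` vertices. -/
theorem numMarked_le {S : Finset ℕ}
    (hS : ∀ a < n, ∀ b < n, ∀ c < n, Obstruct A n a b c → a ∈ S ∨ b ∈ S ∨ c ∈ S) :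
    numMarked A n ≤ 3 * S.card := by
  classical
  rcases Nat.eq_zero_or_pos n with rfl | hn
  · simp [numMarked, rank]
  have hlt : ∀ t < n * n * n, ∀ v, OnTriple n t v → v < n := by
    rintro t ht v (rfl | rfl | rfl)
    · exact Nat.div_lt_of_lt_mul ht
    · exact Nat.mod_lt _ hn
    · exact Nat.mod_lt _ hn
  set T := (Finset.range (n * n * n)).filter (Selected A n) with hT
  have h1 : ∀ t ∈ T, ∃ v ∈ S, OnTriple n t v := by
    intro t ht
    rw [hT, Finset.mem_filter, Finset.mem_range] at ht
    rcases hS _ (hlt t ht.1 _ (Or.inl rfl)) _ (hlt t ht.1 _ (Or.inr (Or.inl rfl))) _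
      (hlt t ht.1 _ (Or.inr (Or.inr rfl))) (selected_iff.1 ht.2).1 with h | h | h
    · exact ⟨_, h, Or.inl rfl⟩
    · exact ⟨_, h, Or.inr (Or.inl rfl)⟩
    · exact ⟨_, h, Or.inr (Or.inr rfl)⟩
  choose! f hfS hf using h1
  -- Selected triples are pairwise disjoint, so the elements of `S` that hit them are distinct.
  have h2 : T.card ≤ S.card := by
    refine Finset.card_le_card_of_injOn f hfS ?_
    intro t ht t' ht' htt
    have hs := Finset.mem_filter.1 (Finset.mem_coe.1 ht)
    have hs' := Finset.mem_filter.1 (Finset.mem_coe.1 ht')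
    have hv := hlt t (Finset.mem_range.1 hs.1) _ (hf t ht)
    have hv' : OnTriple n t' (f t) := htt ▸ hf t' ht'
    rcases lt_trichotomy t t' with h | h | h
    · exact absurd ⟨hv', hf t ht⟩ ((selected_iff.1 hs'.2).2 t h hs.2 _ hv)
    · exact h
    · exact absurd ⟨hf t ht, hv'⟩ ((selected_iff.1 hs.2).2 t' h hs'.2 _ hv)
  have h3 : (Finset.range n).filter (Marked A n) ⊆
      T.biUnion fun t => {t / (n * n), t / n % n, t % n} := by
    intro v hv
    obtain ⟨t, ht, hs, hv⟩ := (Finset.mem_filter.1 hv).2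
    rw [Finset.mem_biUnion]
    exact ⟨t, Finset.mem_filter.2 ⟨Finset.mem_range.2 ht, hs⟩, by simpa [OnTriple] using hv⟩
  rw [numMarked_eq_card]
  refine (Finset.card_le_card h3).trans ((Finset.card_biUnion_le_card_mul _ _ 3 fun t _ =>
    Finset.card_le_three).trans ?_)
  omega

/-! ### The parts of the complete multipartite graph outside of the modulator -/

/-- Without obstructions, non-adjacency is transitive; its classes on the unmarked vertices are the
parts. -/
theorem not_edge_trans {r u v : ℕ} (hr : r < n) (hu : u < n)
    (hv : v < n) (hr' : ¬ Marked A n r) (hu' : ¬ Marked A n u) (hv' : ¬ Marked A n v)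
    (h1 : ¬ Edge A n r u) (h2 : ¬ Edge A n r v) : ¬ Edge A n u v :=
  fun h => not_obstruct_of_not_marked hr hu hv hr' hu' hv' ⟨h1, h2, h⟩

/-- A function that maps every unmarked vertex to the first vertex of its part. -/
theorem IsGraphCode.exists_rep (hA : IsGraphCode A n) : ∃ ρ : ℕ → ℕ,
    (∀ v < n, ¬ Marked A n v → ρ v < n ∧ IsRep A n (ρ v) ∧ InPart A n (ρ v) v) ∧
    (∀ r < n, IsRep A n r → ∀ v < n, InPart A n r v → ρ v = r) ∧
    ∀ u < n, ∀ v < n, ¬ Marked A n u → ¬ Marked A n v → (Edge A n u v ↔ ρ u ≠ ρ v) := by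
  classical
  have h1 : ∀ v, v < n ∧ ¬ Marked A n v → ∃ r < n, IsRep A n r ∧ InPart A n r v := by
    rintro v ⟨hv, hv'⟩
    -- The representative is the least unmarked vertex not adjacent to v.
    have hex : ∃ r, ¬ Marked A n r ∧ ¬ Edge A n r v := ⟨v, hv', hA.irrefl v hv⟩
    have hle := Nat.find_min' hex ⟨hv', hA.irrefl v hv⟩
    obtain ⟨h2, h3⟩ := Nat.find_spec hex
    have hlt := hle.trans_lt hv
    refine ⟨_, hlt, ⟨h2, fun u hu => ?_⟩, hv', h3⟩
    have h4 := Nat.find_min hex hu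
    by_contra h5
    push Not at h5 h4
    have hun := hu.trans hlt
    exact not_edge_trans hlt hun hv h2 h5.1 hv' (fun h => h5.2 (hA.symm _ hlt _ hun h)) h3
      (h4 h5.1)
  choose! ρ hρ using h1
  -- If two representatives were distinct and nonadjacent, the larger would not come first in its
  -- part.
  have huniq : ∀ r < n, ∀ r' < n, IsRep A n r → IsRep A n r' → ¬ Edge A n r r' → r = r' := by
    intro r hr r' hr' h h' he
    rcases lt_trichotomy r r' with hlt | heq | hlt
    · exact ((h'.2 r hlt).elim h.1 he).elim
    · exact heq
    · exact ((h.2 r' hlt).elim h'.1 fun h2 => he (hA.symm _ hr' _ hr h2)).elim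
  refine ⟨ρ, fun v hv hv' => hρ v ⟨hv, hv'⟩, fun r hr hr' v hv hv' => ?_,
    fun u hu v hv hu' hv' => ⟨fun h he => ?_, fun h => ?_⟩⟩
  · obtain ⟨h1, h2, h3⟩ := hρ v ⟨hv, hv'.1⟩
    exact huniq _ h1 _ hr h2 hr' (not_edge_trans hv h1 hr hv'.1 h2.1 hr'.1
      (fun h => h3.2 (hA.symm _ hv _ h1 h)) fun h => hv'.2 (hA.symm _ hv _ hr h))
  · obtain ⟨h1, h2, h3⟩ := hρ u ⟨hu, hu'⟩
    obtain ⟨-, -, h4⟩ := hρ v ⟨hv, hv'⟩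
    exact not_edge_trans h1 hu hv h2.1 hu' hv' h3.2 (he ▸ h4.2) h
  · by_contra he
    obtain ⟨h1, h2, h3⟩ := hρ u ⟨hu, hu'⟩
    obtain ⟨h4, h5, h6⟩ := hρ v ⟨hv, hv'⟩
    have h7 := not_edge_trans hu hv h1 hu' hv' h2.1 he fun h => h3.2 (hA.symm _ hu _ h1 h)
    exact h (huniq _ h1 _ h4 h2 h5 (not_edge_trans hv h1 h4 hv' h2.1 h5.1 h7
      fun h => h6.2 (hA.symm _ hv _ h4 h)))

theorem rank_lt {x : ℕ} (hx : x < n) (hx' : Marked A n x) : rank A n x < numMarked A n := by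
  classical
  exact Nat.count_strict_mono hx' hx

theorem rank_injective {x y : ℕ} (hx : Marked A n x) (hy : Marked A n y)
    (h : rank A n x = rank A n y) : x = y := by
  classical
  exact Nat.count_injective hx hy h

/-! ### Colorings by natural numbers -/

/-- `κ` is a b-coloring with `k` colors of the graph on the numbers below `n` encoded by `A`. -/
structure IsNatBColoring (A : ℕ → Prop) (n k : ℕ) (κ : ℕ → ℕ) : Prop where
  proper : ∀ u < n, ∀ v < n, Edge A n u v → κ u ≠ κ v
  bVertex : ∀ u < n, ∃ v < n, κ v = κ u ∧ ∀ w < n, κ w ≠ κ v → ∃ y < n, Edge A n v y ∧ κ y = κ w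
  card_image : ((Finset.range n).image κ).card = k

end BColoring

namespace BColoring

variable {A : ℕ → Prop} {n : ℕ}

/-! ### Soundness of the decision procedure -/

theorem not_bit_zero {a d : ℕ} : ¬ Bit A n 0 a d := by simp [Bit]

/-- A colored graph whose marked vertices have colors below `m`, and whose unmarked vertices have
either such a color or the color `m`, which stands for the private color of a part. Here `U` is the
set of used colors below `m`, and `P` is the set of parts that have a private color. -/
structure IsLabeling (A : ℕ → Prop) (n m : ℕ) (ρ f : ℕ → ℕ) (U P : ℕ → Prop) : Prop where
  marked_lt : ∀ x < n, Marked A n x → f x < m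
  used : ∀ v < n, f v < m → U (f v)
  private_iff : ∀ r < n, IsRep A n r → (P r ↔ ∃ v < n, InPart A n r v ∧ f v = m)
  exists_used : ∀ d < m, U d → ∃ v < n, f v = d
  le : ∀ v < n, f v ≤ m

open Classical in
/-- The coloring described by a labeling. -/
noncomputable def extendLabeling (m : ℕ) (ρ f : ℕ → ℕ) (v : ℕ) : ℕ :=
  if f v < m then f v else m + ρ v

/-- Used shared colors lie below m, and the private color of the part of r becomes m + r, so the two
kinds never collide and their numbers add up. -/
theorem IsLabeling.card_image {m : ℕ} {ρ f : ℕ → ℕ} {U P : ℕ → Prop} [DecidablePred U]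
    [DecidablePred fun r => IsRep A n r ∧ P r]
    (h : IsLabeling A n m ρ f U P)
    (hρ : ∀ v < n, ¬ Marked A n v → ρ v < n ∧ IsRep A n (ρ v) ∧ InPart A n (ρ v) v)
    (hρ' : ∀ r < n, IsRep A n r → ∀ v < n, InPart A n r v → ρ v = r) :
    ((Finset.range n).image (extendLabeling m ρ f)).card =
      Nat.count U m + Nat.count (fun r => IsRep A n r ∧ P r) n := by
  classical
  have key : (Finset.range n).image (extendLabeling m ρ f) = (Finset.range m).filter U ∪
      ((Finset.range n).filter fun r => IsRep A n r ∧ P r).image (m + ·) := by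
    ext c
    simp only [Finset.mem_image, Finset.mem_union, Finset.mem_filter, Finset.mem_range]
    constructor
    · rintro ⟨v, hv, rfl⟩
      by_cases hf : f v < m
      · left
        simpa [extendLabeling, hf] using h.used v hv hf
      · right
        have hm : ¬ Marked A n v := fun hx => hf (h.marked_lt v hv hx)
        obtain ⟨h1, h2, h3⟩ := hρ v hv hm
        exact ⟨ρ v, ⟨h1, h2, (h.private_iff _ h1 h2).2 ⟨v, hv, h3, by have := h.le v hv; omega⟩⟩,
          by simp [extendLabeling, hf]⟩
    · rintro (⟨hc, hU⟩ | ⟨r, ⟨hr, hr', hP⟩, rfl⟩)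
      · obtain ⟨v, hv, rfl⟩ := h.exists_used c hc hU
        exact ⟨v, hv, by simp [extendLabeling, hc]⟩
      · obtain ⟨v, hv, hp, hf⟩ := (h.private_iff r hr hr').1 hP
        exact ⟨v, hv, by simp [extendLabeling, hf, hρ' r hr hr' v hv hp]⟩
  rw [key, Finset.card_union_of_disjoint, Finset.card_image_of_injective _ (add_right_injective m),
    Nat.count_eq_card_filter_range, Nat.count_eq_card_filter_range]
  rw [Finset.disjoint_left]
  intro c hc hc'
  obtain ⟨r, -, rfl⟩ := Finset.mem_image.1 hc'
  have := Finset.mem_range.1 (Finset.mem_filter.1 hc).1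
  omega

/-- The vertex pieces prescribe a color for every unmarked vertex and `col` one for every marked
vertex; `extendLabeling` turns label m into one color per part. The tasks in τ then provide all
neighbors that the b-vertices need. -/
theorem exists_natBColoring_of_hasCertificate (hA : IsGraphCode A n) {k M : ℕ}
    (h : HasCertificate A n k M) : ∃ κ, IsNatBColoring A n k κ := by
  classical
  obtain ⟨ρ, hρ, hρ', hedge⟩ := hA.exists_rep
  obtain ⟨col, -, U, -, Bs, -, τ, -, ⟨hc1, hc2⟩, ⟨hb1, hb2⟩, hk, μ, hμ, hμτ, hμd⟩ := h
  unfold HasNumColors at hk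
  set m := numMarked A n with hm
  have hτ : ∀ a d, Bit A n τ a d ↔ ∃ r < n, Bit A n (μ r) a d := fun a d => hμτ _
  have hrep : ∀ r < n, ∀ a d, Bit A n (μ r) a d → IsRep A n r := by
    intro r hr a d hb
    rcases hμ r hr with ⟨-, h0⟩ | h0
    · exact absurd (h0 ▸ hb) not_bit_zero
    · exact h0.1
  have hlam : ∀ r, r < n ∧ IsRep A n r → ∃ lam,
      RAM.BitPartition (VertexServes A n col U τ lam r) n lam ∧
      (∀ a < m + 2, ∀ d < m, Bit A n (μ r) a d ↔ Bit A n lam a d) ∧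
      (PrivatePart A n Bs lam (μ r) ∨ TokenPart A n lam (μ r)) := by
    rintro r ⟨hr, hr'⟩
    rcases hμ r hr with ⟨h0, -⟩ | ⟨-, lam, -, h0⟩
    · exact absurd hr' h0
    · exact ⟨lam, h0⟩
  choose! lam hlam using hlam
  have hw := fun r hr => (hlam r hr).1
  choose! w hw using hw
  have hc : ∀ v, v < n ∧ ¬ Marked A n v → ∃ c < m + 1,
      Allowed A n col U (lam (ρ v)) v c ∧ ∀ d < m + 1,
      (∀ x < n, Marked A n x → Bit A n (w (ρ v) v) (rank A n x) d → c = d ∧ Edge A n x v) ∧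
      (Bit A n (w (ρ v) v) m d → c = d) ∧
      (Bit A n (w (ρ v) v) (m + 1) d → c = d ∧ SeesAll A n col U τ (lam (ρ v)) v c) := by
    rintro v ⟨hv, hv'⟩
    obtain ⟨h1, h2, h3⟩ := hρ v hv hv'
    rcases (hw _ ⟨h1, h2⟩).1 v hv with ⟨h0, -⟩ | ⟨-, h0⟩
    · exact absurd h3 h0
    · exact h0
  choose! c hcm hcA hcw using hc
  choose! e hem heb heU heq using hc1
  set f : ℕ → ℕ := fun v => if Marked A n v then e v else c v with hf
  have fM : ∀ x, Marked A n x → f x = e x := fun x hx => by simp [hf, hx]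
  have fN : ∀ x, ¬ Marked A n x → f x = c x := fun x hx => by simp [hf, hx]
  -- every task of a part is fulfilled by one of its vertices
  have serve : ∀ r < n, IsRep A n r → ∀ a d, Bit A n (lam r) a d → d < m + 1 → ∃ v < n,
      InPart A n r v ∧ ρ v = r ∧
      (∀ x < n, Marked A n x → a = rank A n x → f v = d ∧ Edge A n x v) ∧
      (a = m → f v = d) ∧
      (a = m + 1 → f v = d ∧ SeesAll A n col U τ (lam r) v d) := by
    intro r hr hr' a d hb hd
    obtain ⟨v, hv, hwb⟩ := ((hw r ⟨hr, hr'⟩).2.1 _).1 hb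
    have hp : InPart A n r v := by
      rcases (hw r ⟨hr, hr'⟩).1 v hv with ⟨-, h0⟩ | h0
      · rw [h0] at hwb; simp at hwb
      · exact h0.1
    have hρv := hρ' r hr hr' v hv hp
    have h1 := hcw v ⟨hv, hp.1⟩ d hd
    rw [hρv] at h1
    refine ⟨v, hv, hp, hρv, fun x hx hx' ha => ?_, fun ha => ?_, fun ha => ?_⟩
    · rw [fN v hp.1]; exact h1.1 x hx hx' (ha ▸ hwb)
    · rw [fN v hp.1]; exact h1.2.1 (ha ▸ hwb)
    · rw [fN v hp.1]
      obtain ⟨h2, h3⟩ := h1.2.2 (ha ▸ hwb)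
      exact ⟨h2, h2 ▸ h3⟩
  have cur : ∀ v < n, ¬ Marked A n v → Bit A n (lam (ρ v)) m (f v) := by
    intro v hv hv'
    rw [fN v hv']
    exact (hcA v ⟨hv, hv'⟩).1
  have colEq : ∀ x < n, Marked A n x → ∀ d < m, Bit A n col (rank A n x) d → f x = d := by
    intro x hx hx' d hd hb
    rw [fM x hx']
    exact (heq x hx hx' d hd hb).symm
  -- tasks of `τ` with small colors belong to exactly one part
  have task : ∀ a < m + 2, ∀ d < m, Bit A n τ a d → ∃ r < n, IsRep A n r ∧
      Bit A n (lam r) a d := by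
    intro a ha d hd hb
    obtain ⟨r, hr, hb⟩ := (hτ a d).1 hb
    have hr' := hrep r hr a d hb
    exact ⟨r, hr, hr', ((hlam r ⟨hr, hr'⟩).2.1 a ha d hd).1 hb⟩
  -- For a = m this says that no shared color occurs on unmarked vertices of two parts.
  have taskUniq : ∀ a < m + 2, ∀ d < m, ∀ r < n, ∀ r' < n, IsRep A n r → IsRep A n r' →
      Bit A n (lam r) a d → Bit A n (lam r') a d → r = r' := by
    intro a ha d hd r hr r' hr' h1 h2 h3 h4
    exact hμd r hr r' hr' _ (((hlam r ⟨hr, h1⟩).2.1 a ha d hd).2 h3)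
      (((hlam r' ⟨hr', h2⟩).2.1 a ha d hd).2 h4)
  have hlab : IsLabeling A n m ρ f (fun d => U.testBit d = true)
      (fun r => Bit A n (lam r) m m) := by
    refine ⟨fun x hx hx' => ?_, fun v hv hv' => ?_, fun r hr hr' => ⟨fun hb => ?_, ?_⟩,
      fun d hd hU => ?_, fun v hv => ?_⟩
    · rw [fM x hx']; exact hem x hx hx'
    · by_cases hx : Marked A n v
      · rw [fM v hx]; exact heU v hv hx
      · rw [fN v hx] at hv' ⊢; exact ((hcA v ⟨hv, hx⟩).2 hv').1
    · obtain ⟨v, hv, hp, -, -, h1, -⟩ := serve r hr hr' m m hb (by omega)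
      exact ⟨v, hv, hp, h1 rfl⟩
    · rintro ⟨v, hv, hp, h1⟩
      have := cur v hv hp.1
      rwa [hρ' r hr hr' v hv hp, h1] at this
    · rcases hb1 d hd hU with hb | ⟨x, hx, hx', -, hb⟩
      · obtain ⟨r, hr, hr', hb⟩ := task _ (by omega) d hd hb
        obtain ⟨v, hv, -, -, -, -, h1⟩ := serve r hr hr' _ d hb (by omega)
        exact ⟨v, hv, (h1 rfl).1⟩
      · exact ⟨x, hx, colEq x hx hx' d hd hb⟩
    · by_cases hx : Marked A n v
      · rw [fM v hx]; exact (hem v hv hx).le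
      · rw [fN v hx]; exact Nat.le_of_lt_succ (hcm v ⟨hv, hx⟩)
  set κ := extendLabeling m ρ f with hκ
  have κlow : ∀ v, f v < m → κ v = f v := fun v hv => by simp [hκ, extendLabeling, hv]
  have κpriv : ∀ v, f v = m → κ v = m + ρ v := fun v hv => by simp [hκ, extendLabeling, hv]
  have flt : ∀ v < n, f v < m ∨ (f v = m ∧ ¬ Marked A n v) := by
    intro v hv
    rcases (hlab.le v hv).lt_or_eq with h1 | h1
    · exact Or.inl h1
    · exact Or.inr ⟨h1, fun hx => absurd (hlab.marked_lt v hv hx) (by omega)⟩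
  have seen : ∀ v < n, ∀ d < m, SeenMarked A n col v d → ∃ y < n, Edge A n v y ∧ κ y = d := by
    rintro v hv d hd ⟨x, hx, hx', he, hb⟩
    have h1 := colEq x hx hx' d hd hb
    exact ⟨x, hx, hA.symm _ hx _ hv he, by rw [κlow x (by omega), h1]⟩
  -- unmarked b-vertices
  have bUnmarked : ∀ v < n, ¬ Marked A n v → SeesAll A n col U τ (lam (ρ v)) v (f v) →
      ∀ w < n, κ w ≠ κ v → ∃ y < n, Edge A n v y ∧ κ y = κ w := by
    intro v hv hv' hs w hw hne
    obtain ⟨r1, r2, r3⟩ := hρ v hv hv'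
    rcases flt w hw with h1 | ⟨h1, hw'⟩
    · rw [κlow w h1] at hne ⊢
      have hne' : f w ≠ f v := by
        intro h2
        rw [κlow v (by omega)] at hne
        exact hne h2
      rcases hs.2 (f w) h1 (hlab.used w hw h1) hne' with h2 | ⟨h2, h3⟩
      · exact seen v hv _ h1 h2
      · obtain ⟨r, hr, hr', hb⟩ := task m (by omega) _ h1 h2
        obtain ⟨y, hy, hp, hry, -, h4, -⟩ := serve r hr hr' _ _ hb (by omega)
        refine ⟨y, hy, (hedge v hv y hy hv' hp.1).2 ?_,
          by rw [κlow y (by rw [h4 rfl]; omega), h4 rfl]⟩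
        rintro h5
        rw [h5, hry] at h3
        exact h3 hb
    -- Private colors of other parts are seen automatically, since distinct parts are completely
    -- joined. A private color of v's own part is either the color of v or excluded by `SeesAll`.
    · refine ⟨w, hw, (hedge v hv w hw hv' hw').2 fun h2 => ?_, rfl⟩
      have h3 := cur w hw hw'
      rw [h1, ← h2] at h3
      rcases flt v hv with h4 | ⟨h4, -⟩
      · exact hs.1 h4 h3
      · rw [κpriv v h4, κpriv w h1, h2] at hne
        exact hne rfl
  have bMarked : ∀ x < n, Marked A n x → Bs.testBit (rank A n x) = true →
      ∀ w < n, κ w ≠ κ x → ∃ y < n, Edge A n x y ∧ κ y = κ w := by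
    intro x hx hx' hB w hw hne
    have hfx := hlab.marked_lt x hx hx'
    rw [κlow x hfx] at hne
    rcases flt w hw with h1 | ⟨h1, hw'⟩
    · rw [κlow w h1] at hne ⊢
      rcases hb2 x hx hx' hB _ h1 (hlab.used w hw h1) with h2 | h2 | h2
      · exact absurd (colEq x hx hx' _ h1 h2).symm hne
      · exact seen x hx _ h1 h2
      · obtain ⟨r, hr, hr', hb⟩ := task _ (by have := rank_lt hx hx'; omega) _ h1 h2
        obtain ⟨y, hy, -, -, h3, -, -⟩ := serve r hr hr' _ _ hb (by omega)
        obtain ⟨h4, h5⟩ := h3 x hx hx' rfl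
        exact ⟨y, hy, h5, by rw [κlow y (by omega), h4]⟩
    -- For a private color, `PrivatePart` demands a vertex of that color next to every marked
    -- b-vertex.
    · obtain ⟨r1, r2, r3⟩ := hρ w hw hw'
      have h3 := cur w hw hw'
      rw [h1] at h3
      rcases (hlam _ ⟨r1, r2⟩).2.2 with h4 | h4
      · obtain ⟨y, hy, -, hry, h5, -, -⟩ := serve _ r1 r2 _ _ (h4.2.2.1 x hx hx' hB) (by omega)
        obtain ⟨h6, h7⟩ := h5 x hx hx' rfl
        exact ⟨y, hy, h7, by rw [κpriv y h6, κpriv w h1, hry]⟩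
      · exact absurd h3 h4.1
  refine ⟨κ, fun u hu v hv he heq => ?_, fun u hu => ?_, ?_⟩
  · -- the coloring is proper
    have mixed : ∀ x < n, ∀ v < n, Marked A n x → ¬ Marked A n v → Edge A n x v → κ x ≠ κ v := by
      intro x hx v hv hx' hv' he heq
      have hfx := hlab.marked_lt x hx hx'
      rw [κlow x hfx] at heq
      rcases flt v hv with h1 | ⟨h1, -⟩
      · rw [κlow v h1] at heq
        have h2 := (hcA v ⟨hv, hv'⟩).2 (fN v hv' ▸ h1)
        refine h2.2 ⟨x, hx, hx', he, ?_⟩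
        rw [← fN v hv', ← heq, fM x hx']
        exact heb x hx hx'
      · rw [κpriv v h1] at heq
        omega
    by_cases hu' : Marked A n u <;> by_cases hv' : Marked A n v
    · rw [κlow u (hlab.marked_lt u hu hu'), κlow v (hlab.marked_lt v hv hv')] at heq
      have h1 := heb u hu hu'
      have h2 := heb v hv hv'
      rw [← fM v hv', ← heq] at h2
      rw [← fM u hu'] at h1
      exact hc2 u hu v hv hu' hv' he _ (hlab.marked_lt u hu hu') ⟨h1, h2⟩
    · exact mixed u hu v hv hu' hv' he heq
    · exact mixed v hv u hu hv' hu' (hA.symm _ hu _ hv he) heq.symm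
    · have hne := (hedge u hu v hv hu' hv').1 he
      obtain ⟨r1, r2, r3⟩ := hρ u hu hu'
      obtain ⟨q1, q2, q3⟩ := hρ v hv hv'
      rcases flt u hu with h1 | ⟨h1, -⟩ <;> rcases flt v hv with h2 | ⟨h2, -⟩
      · rw [κlow u h1, κlow v h2] at heq
        exact hne (taskUniq m (by omega) _ h1 _ r1 _ q1 r2 q2 (cur u hu hu')
          (heq ▸ cur v hv hv'))
      · rw [κlow u h1, κpriv v h2] at heq; omega
      · rw [κlow v h2, κpriv u h1] at heq; omega
      · rw [κpriv v h2, κpriv u h1] at heq; omega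
  · -- every color has a b-vertex
    rcases flt u hu with h1 | ⟨h1, hu'⟩
    · rcases hb1 _ h1 (hlab.used u hu h1) with hb | ⟨x, hx, hx', hB, hb⟩
      · obtain ⟨r, hr, hr', hb⟩ := task _ (by omega) _ h1 hb
        obtain ⟨v, hv, hp, hrv, -, -, h2⟩ := serve r hr hr' _ _ hb (by omega)
        obtain ⟨h3, h4⟩ := h2 rfl
        exact ⟨v, hv, by rw [κlow v (by omega), κlow u h1, h3],
          bUnmarked v hv hp.1 (by rw [hrv, h3]; exact h4)⟩
      · exact ⟨x, hx, by rw [κlow x (hlab.marked_lt x hx hx'), κlow u h1,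
          colEq x hx hx' _ h1 hb], bMarked x hx hx' hB⟩
    · obtain ⟨r1, r2, r3⟩ := hρ u hu hu'
      have h3 := cur u hu hu'
      rw [h1] at h3
      rcases (hlam _ ⟨r1, r2⟩).2.2 with h4 | h4
      · obtain ⟨v, hv, hp, hrv, -, -, h2⟩ := serve _ r1 r2 _ _ h4.2.1 (by omega)
        obtain ⟨h5, h6⟩ := h2 rfl
        exact ⟨v, hv, by rw [κpriv v h5, κpriv u h1, hrv],
          bUnmarked v hv hp.1 (by rw [hrv, h5]; exact h6)⟩
      · exact absurd h3 h4.1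
  · rw [hlab.card_image hρ hρ']
    have h1 : Nat.count (IsRep A n) n = Nat.count (fun r => IsRep A n r ∧ Bit A n (lam r) m m) n +
        Nat.count (Bit A n τ (m + 2)) m := by
      -- Tokens correspond bijectively to parts without a private color: each such part owns exactly
      -- one, disjointness gives injectivity, and private parts own none.
      have h2 : Nat.count (Bit A n τ (m + 2)) m =
          Nat.count (fun r => IsRep A n r ∧ ¬ Bit A n (lam r) m m) n := by
        simp only [Nat.count_eq_card_filter_range]
        symm
        have tok : ∀ r < n, IsRep A n r → ¬ Bit A n (lam r) m m → ∃ d < m,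
            Bit A n (μ r) (m + 2) d ∧ ∀ d' < m, Bit A n (μ r) (m + 2) d' → d' = d := by
          intro r hr hr' hb
          rcases (hlam r ⟨hr, hr'⟩).2.2 with h4 | h4
          · exact absurd h4.1 hb
          · exact h4.2
        choose! t htm htb htu using tok
        refine Finset.card_nbij t ?_ ?_ ?_
        · intro r hr
          simp only [Finset.mem_range, Finset.coe_filter,
            Set.mem_ofPred_eq] at hr ⊢
          exact ⟨htm r hr.1 hr.2.1 hr.2.2, (hτ _ _).2 ⟨r, hr.1, htb r hr.1 hr.2.1 hr.2.2⟩⟩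
        · intro r hr r' hr' heq
          simp only [Finset.mem_range, Finset.coe_filter, Set.mem_ofPred_eq] at hr hr'
          exact hμd r hr.1 r' hr'.1 _ (htb r hr.1 hr.2.1 hr.2.2)
            (heq ▸ htb r' hr'.1 hr'.2.1 hr'.2.2)
        · intro d hd
          simp only [Finset.mem_range, Finset.coe_filter, Set.mem_ofPred_eq] at hd
          obtain ⟨r, hr, hb⟩ := (hτ _ _).1 hd.2
          have hr' := hrep r hr _ _ hb
          have hn : ¬ Bit A n (lam r) m m := by
            rcases (hlam r ⟨hr, hr'⟩).2.2 with h4 | h4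
            · exact absurd hb (h4.2.2.2 d hd.1)
            · exact h4.1
          refine ⟨r, ?_, (htu r hr hr' hn d hd.1 hb).symm⟩
          simp only [Finset.mem_range, Finset.coe_filter, Set.mem_ofPred_eq]
          exact ⟨hr, hr', hn⟩
      rw [h2]
      simp only [Nat.count_eq_card_filter_range]
      rw [← Finset.filter_filter, ← Finset.filter_filter, Finset.card_filter_add_card_filter_not]
    omega

end BColoring

namespace BColoring

variable {A : ℕ → Prop} {n : ℕ}

/-! ### Completeness of the decision procedure -/

theorem exists_testBit_iff (L : ℕ) (P : ℕ → Prop) :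
    ∃ σ < 2 ^ L, ∀ i, σ.testBit i = true ↔ i < L ∧ P i := by
  classical
  refine ⟨Nat.ofBits fun i : Fin L => decide (P i), Nat.ofBits_lt_two_pow _, fun i => ?_⟩
  by_cases h : i < L
  · simp [Nat.testBit_ofBits_lt _ i h, h]
  · simp [Nat.testBit_ofBits_ge _ i (not_lt.1 h), h]

/-- Position a (m + 1) + d decodes to (a, d) by quotient and remainder, and m + 3 rows of m + 1
entries fill exactly L bits. -/
theorem bit_iff {σ L a d : ℕ} {R : ℕ → ℕ → Prop}
    (hσ : ∀ i, σ.testBit i = true ↔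
      i < L ∧ R (i / (numMarked A n + 1)) (i % (numMarked A n + 1)))
    (hL : L = (numMarked A n + 3) * (numMarked A n + 1)) (ha : a < numMarked A n + 3)
    (hd : d < numMarked A n + 1) : Bit A n σ a d ↔ R a d := by
  have h1 : a * (numMarked A n + 1) + d < L := by
    rw [hL]
    nlinarith
  rw [Bit, hσ, Nat.mul_add_mod', Nat.mod_eq_of_lt hd, mul_comm, Nat.mul_add_div (by omega),
    Nat.div_eq_of_lt hd, add_zero, mul_comm]
  exact and_iff_right h1

/-- Sending each value of f to the value of g at a preimage covers the image of g. Used in both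
directions, this shows that colorings with the same color classes use equally many colors. -/
theorem card_image_le_of_imp {s : Finset ℕ} {f g : ℕ → ℕ}
    (h : ∀ u ∈ s, ∀ v ∈ s, f u = f v → g u = g v) : (s.image g).card ≤ (s.image f).card := by
  classical
  have h1 : ∀ c ∈ s.image f, ∃ u ∈ s, f u = c := fun c hc => by simpa using hc
  choose! p hp hp' using h1
  refine (Finset.card_le_card (t := (s.image f).image fun c => g (p c)) ?_).trans
    Finset.card_image_le
  intro c hc
  obtain ⟨v, hv, rfl⟩ := Finset.mem_image.1 hc
  have hv' := Finset.mem_image_of_mem f hv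
  exact Finset.mem_image.2 ⟨f v, hv', h _ (hp _ hv') _ hv (hp' _ hv')⟩

/-- All colors other than the color of `v` occur in the neighborhood of `v`. -/
def IsNatBVertex (A : ℕ → Prop) (n : ℕ) (κ : ℕ → ℕ) (v : ℕ) : Prop :=
  ∀ w < n, κ w ≠ κ v → ∃ y < n, Edge A n v y ∧ κ y = κ w

/-- All guessed numbers are read off from the coloring, after relabeling its shared colors by
numbers below m and its private colors by m. -/
theorem hasCertificate_of_isNatBColoring (hA : IsGraphCode A n) {k : ℕ} {κ : ℕ → ℕ}
    (hκ : IsNatBColoring A n k κ) :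
    HasCertificate A n k (2 ^ ((numMarked A n + 3) * (numMarked A n + 1))) := by
  classical
  obtain ⟨ρ, hρ, hρ', hedge⟩ := hA.exists_rep
  obtain ⟨proper, bVertex, card_image⟩ := hκ
  generalize hm : numMarked A n = m
  generalize hL : (m + 3) * (m + 1) = L
  have hmL : m ≤ L := by rw [← hL]; nlinarith
  -- labels of the colors
  let C : ℕ → Prop := fun c => ∃ x < n, Marked A n x ∧ κ x = c
  have hC : ∀ c, C c → ∃ x < n, Marked A n x ∧ κ x = c := fun c h => h
  choose! g hgn hgM hgκ using hC
  -- A color on marked vertices is named by the rank of one chosen marked vertex that carries it,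
  -- hence by a number below m.
  obtain ⟨f, hf⟩ : ∃ f : ℕ → ℕ, ∀ v, f v = if C (κ v) then rank A n (g (κ v)) else m :=
    ⟨_, fun _ => rfl⟩
  have fC : ∀ v, C (κ v) → f v < m := fun v hv => by
    rw [hf, if_pos hv, ← hm]; exact rank_lt (hgn _ hv) (hgM _ hv)
  have fC' : ∀ v, f v < m → C (κ v) := fun v hv => by
    by_contra h; rw [hf, if_neg h] at hv; omega
  have fle : ∀ v, f v ≤ m := fun v => by
    by_cases h : C (κ v)
    · exact (fC v h).le
    · rw [hf, if_neg h]
  have fM : ∀ x < n, Marked A n x → f x < m := fun x hx hx' => fC x ⟨x, hx, hx', rfl⟩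
  have fκ : ∀ u v, κ u = κ v → f u = f v := fun u v h => by rw [hf, hf, h]
  have κf : ∀ u v, f u < m → f u = f v → κ u = κ v := fun u v h1 h2 => by
    have h3 := fC' u h1
    have h4 := fC' v (h2 ▸ h1)
    rw [hf, hf, if_pos h3, if_pos h4] at h2
    rw [← hgκ _ h3, ← hgκ _ h4, rank_injective (hgM _ h3) (hgM _ h4) h2]
  -- two unmarked vertices with the same color are in the same part
  have samePart : ∀ u < n, ∀ v < n, ¬ Marked A n u → ¬ Marked A n v → κ u = κ v → ρ u = ρ v := by
    intro u hu v hv hu' hv' h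
    by_contra h1
    exact proper u hu v hv ((hedge u hu v hv hu' hv').2 h1) h
  have privUnmarked : ∀ u < n, f u = m → ¬ Marked A n u := fun u hu hu' h => by
    have := fM u hu h; omega
  -- a b-vertex sees every private color in its part
  have seesPriv : ∀ v < n, IsNatBVertex A n κ v → ∀ w < n, f w = m → κ w ≠ κ v →
      ∃ y < n, Edge A n v y ∧ ¬ Marked A n y ∧ f y = m ∧ ρ y = ρ w := by
    intro v hv hb w hw hfw hne
    obtain ⟨y, hy, he, hyw⟩ := hb w hw hne
    have hfy : f y = m := (fκ y w hyw).trans hfw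
    exact ⟨y, hy, he, privUnmarked y hy hfy, hfy, samePart y hy w hw (privUnmarked y hy hfy)
      (privUnmarked w hw hfw) hyw⟩
  -- The neighbor of v carrying the private color would lie in the part of v, which is independent.
  have notOwnPart : ∀ v < n, ¬ Marked A n v → IsNatBVertex A n κ v → ∀ w < n, f w = m →
      ρ w = ρ v → κ w = κ v := by
    intro v hv hv' hb w hw hfw hr
    by_contra hne
    obtain ⟨y, hy, he, hy', -, hry⟩ := seesPriv v hv hb w hw hfw hne
    exact (hedge v hv y hy hv' hy').1 he (hr.symm.trans hry.symm)
  have privB : ∀ u < n, f u = m → ∃ v < n, ¬ Marked A n v ∧ f v = m ∧ ρ v = ρ u ∧ κ v = κ u ∧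
      IsNatBVertex A n κ v := by
    intro u hu hfu
    obtain ⟨v, hv, hvu, hb⟩ := bVertex u hu
    have hfv : f v = m := (fκ v u hvu).trans hfu
    exact ⟨v, hv, privUnmarked v hv hfv, hfv, samePart v hv u hu (privUnmarked v hv hfv)
      (privUnmarked u hu hfu) hvu, hvu, hb⟩
  -- At most one private color per part: compare both vertices with the b-vertex of one of the
  -- colors.
  have privEq : ∀ u < n, ∀ v < n, f u = m → f v = m → ρ u = ρ v → κ u = κ v := by
    intro u hu v hv hfu hfv hr
    obtain ⟨y, hy, hy', -, hry, hκy, hb⟩ := privB v hv hfv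
    rw [← hκy]
    exact notOwnPart y hy hy' hb u hu hfu (hr.trans hry.symm)
  -- the tasks
  let Wit : ℕ → ℕ → ℕ → Prop := fun a v d => f v = d ∧
    ((∃ x < n, Marked A n x ∧ rank A n x = a ∧ Edge A n x v) ∨ a = m ∨
      (a = m + 1 ∧ IsNatBVertex A n κ v))
  let lamR : ℕ → ℕ → ℕ → Prop := fun r a d => ∃ v < n, InPart A n r v ∧ Wit a v d
  -- The token of a part without a private color is the color of its first vertex. Distinct parts
  -- get distinct tokens, because a color of unmarked vertices stays within one part.
  let muR : ℕ → ℕ → ℕ → Prop := fun r a d => IsRep A n r ∧ d < m ∧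
    ((a < m + 2 ∧ lamR r a d) ∨ (a = m + 2 ∧ f r = d ∧ ¬ lamR r m m))
  obtain ⟨col, hcolM, hcol⟩ := exists_testBit_iff L fun i =>
    ∃ x < n, Marked A n x ∧ rank A n x = i / (m + 1) ∧ f x = i % (m + 1)
  obtain ⟨U, hUM, hU⟩ := exists_testBit_iff L fun d => ∃ v < n, f v = d
  obtain ⟨Bs, hBsM, hBs⟩ := exists_testBit_iff L fun a =>
    ∃ x < n, Marked A n x ∧ rank A n x = a ∧ IsNatBVertex A n κ x
  obtain ⟨τ, hτM, hτ⟩ := exists_testBit_iff L fun i =>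
    ∃ r < n, muR r (i / (m + 1)) (i % (m + 1))
  have hμ := fun r => exists_testBit_iff L fun i => muR r (i / (m + 1)) (i % (m + 1))
  have hlam := fun r => exists_testBit_iff L fun i => lamR r (i / (m + 1)) (i % (m + 1))
  choose μ hμM hμ using hμ
  choose lam hlamM hlam using hlam
  subst hm
  set m := numMarked A n with hm
  have rlt : ∀ x < n, Marked A n x → rank A n x < m := fun x hx hx' => rank_lt hx hx'
  have colBit : ∀ x < n, Marked A n x → ∀ d < m + 1, Bit A n col (rank A n x) d ↔ f x = d := by
    intro x hx hx' d hd
    rw [bit_iff (R := fun a d => ∃ x < n, Marked A n x ∧ rank A n x = a ∧ f x = d) hcol hL.symm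
      (by have := rlt x hx hx'; omega) hd]
    constructor
    · rintro ⟨y, hy, hy', h1, h2⟩
      rwa [← rank_injective hy' hx' h1]
    · intro h
      exact ⟨x, hx, hx', rfl, h⟩
  have UBit : ∀ d < m, U.testBit d = true ↔ ∃ v < n, f v = d := fun d hd => by
    rw [hU]; exact and_iff_right (by omega)
  have BsBit : ∀ x < n, Marked A n x → (Bs.testBit (rank A n x) = true ↔
      IsNatBVertex A n κ x) := by
    intro x hx hx'
    rw [hBs]
    constructor
    · rintro ⟨-, y, hy, hy', h1, h2⟩
      rwa [← rank_injective hy' hx' h1]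
    · intro h
      exact ⟨by have := rlt x hx hx'; omega, x, hx, hx', rfl, h⟩
  have lamBit : ∀ r, ∀ a < m + 3, ∀ d < m + 1, Bit A n (lam r) a d ↔ lamR r a d :=
    fun r a ha d hd => bit_iff (hlam r) hL.symm ha hd
  have μBit : ∀ r, ∀ a < m + 3, ∀ d < m + 1, Bit A n (μ r) a d ↔ muR r a d :=
    fun r a ha d hd => bit_iff (hμ r) hL.symm ha hd
  have τBit : ∀ a < m + 3, ∀ d < m + 1, Bit A n τ a d ↔ ∃ r < n, muR r a d :=
    fun a ha d hd => bit_iff (R := fun a d => ∃ r < n, muR r a d) hτ hL.symm ha hd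
  have inPart : ∀ v < n, ¬ Marked A n v → ∀ r, ρ v = r → InPart A n r v := by
    rintro v hv hv' r rfl
    exact (hρ v hv hv').2.2
  have seenBit : ∀ v < n, ∀ y < n, Marked A n y → Edge A n v y → ∀ d < m, f y = d →
      SeenMarked A n col v d := fun v hv y hy hy' he d hd h =>
    ⟨y, hy, hy', hA.symm _ hv _ hy he, (colBit y hy hy' d (by omega)).2 h⟩
  have taskBit : ∀ v < n, ¬ Marked A n v → ∀ a < m + 2, ∀ d < m, Wit a v d → Bit A n τ a d := by
    intro v hv hv' a ha d hd h
    obtain ⟨r1, r2, r3⟩ := hρ v hv hv'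
    exact (τBit a (by omega) d (by omega)).2 ⟨ρ v, r1, r2, hd, Or.inl ⟨ha, v, hv, r3, h⟩⟩
  have lamPart : ∀ r < n, IsRep A n r → ∀ a d, lamR r a d → ∃ v < n, ¬ Marked A n v ∧ ρ v = r ∧
      f v = d := by
    rintro r hr hr' a d ⟨v, hv, hp, h, -⟩
    exact ⟨v, hv, hp.1, hρ' r hr hr' v hv hp, h⟩
  have muPart : ∀ r < n, ∀ a d, muR r a d → ∃ v < n, ¬ Marked A n v ∧ ρ v = r ∧ f v = d := by
    rintro r hr a d ⟨hr', -, ⟨-, h⟩ | ⟨-, h, -⟩⟩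
    · exact lamPart r hr hr' a d h
    · exact ⟨r, hr, hr'.1, hρ' r hr hr' r hr ⟨hr'.1, hA.irrefl r hr⟩, h⟩
  have sees : ∀ v < n, ¬ Marked A n v → IsNatBVertex A n κ v →
      SeesAll A n col U τ (lam (ρ v)) v (f v) := by
    intro v hv hv' hb
    obtain ⟨r1, r2, r3⟩ := hρ v hv hv'
    refine ⟨fun hlt h => ?_, fun d hd hUd hne => ?_⟩
    · obtain ⟨u, hu, hu', hru, hfu⟩ := lamPart _ r1 r2 _ _
        ((lamBit _ _ (by omega) _ (by omega)).1 h)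
      have h1 := fκ u v (notOwnPart v hv hv' hb u hu hfu hru)
      omega
    · obtain ⟨u, hu, hfu⟩ := (UBit d hd).1 hUd
      obtain ⟨y, hy, he, hyu⟩ := hb u hu fun h => hne (hfu.symm.trans (fκ _ _ h))
      have hfy : f y = d := (fκ y u hyu).trans hfu
      by_cases hy' : Marked A n y
      · exact Or.inl (seenBit v hv y hy hy' he d hd hfy)
      -- Were d present in v's own part, then y, having the same color, would lie there too, yet it
      -- is adjacent to v.
      · refine Or.inr ⟨taskBit y hy hy' m (by omega) d hd ⟨hfy, Or.inr (Or.inl rfl)⟩, fun h => ?_⟩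
        obtain ⟨z, hz, hz', hrz, hfz⟩ := lamPart _ r1 r2 _ _
          ((lamBit _ _ (by omega) _ (by omega)).1 h)
        have h1 := samePart z hz y hy hz' hy' (κf z y (by omega) (hfz.trans hfy.symm))
        exact (hedge v hv y hy hv' hy').1 he (hrz.symm.trans h1)
  -- the vertices of a part fulfill its tasks
  have serve : ∀ r < n, IsRep A n r →
      RAM.BitPartition (VertexServes A n col U τ (lam r) r) n (lam r) := by
    intro r hr hr'
    have h1 : ∀ i, (lam r).testBit i = true → ∃ v < n, InPart A n r v ∧
        Wit (i / (m + 1)) v (i % (m + 1)) := fun i hi => ((hlam r i).1 hi).2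
    -- Each task is assigned to one witness `h i`, so the pieces are disjoint even if several
    -- vertices could serve.
    choose! h hhn hhp hhw using h1
    have hw := fun v => exists_testBit_iff L fun i => (lam r).testBit i = true ∧ h i = v
    choose w hwM hw using hw
    have wBit : ∀ v, ∀ a < m + 2, ∀ d < m + 1, Bit A n (w v) a d → Wit a v d := by
      intro v a ha d hd hb
      obtain ⟨-, h2, h3⟩ := (hw v _).1 hb
      have h4 := hhw _ h2
      rwa [h3, ← hm, Nat.mul_add_mod', Nat.mod_eq_of_lt hd, mul_comm, Nat.mul_add_div (by omega),
        Nat.div_eq_of_lt hd, add_zero] at h4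
    refine ⟨w, fun v hv => ?_, fun i => ?_, fun u _ v _ i h1 h2 => ?_⟩
    · by_cases hp : InPart A n r v
      · refine Or.inr ⟨hp, f v, by have := fle v; omega, ⟨?_, fun hlt => ⟨?_, ?_⟩⟩,
          fun d hd => ⟨fun x hx hx' hb => ?_, fun hb => ?_, fun hb => ?_⟩⟩
        · exact (lamBit r _ (by omega) _ (by have := fle v; omega)).2
            ⟨v, hv, hp, rfl, Or.inr (Or.inl rfl)⟩
        · exact (UBit _ hlt).2 ⟨v, hv, rfl⟩
        · rintro ⟨x, hx, hx', he, hb⟩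
          have h2 := (colBit x hx hx' _ (by omega)).1 hb
          exact proper x hx v hv he (κf x v (by omega) h2)
        · have hlt := rlt x hx hx'
          obtain ⟨h2, ⟨y, hy, hy', h3, h4⟩ | h3 | ⟨h3, -⟩⟩ := wBit v _ (by omega) d hd hb
          · exact ⟨h2, rank_injective hy' hx' h3 ▸ h4⟩
          · omega
          · omega
        · exact (wBit v _ (by omega) d hd hb).1
        · obtain ⟨h2, ⟨y, hy, hy', h3, h4⟩ | h3 | ⟨-, h3⟩⟩ := wBit v _ (by omega) d hd hb
          · have := rlt y hy hy'; omega
          · omega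
          · exact ⟨h2, hρ' r hr hr' v hv hp ▸ sees v hv hp.1 h3⟩
      · refine Or.inl ⟨hp, Nat.eq_of_testBit_eq fun i => ?_⟩
        rw [Nat.zero_testBit, Bool.eq_false_iff]
        intro hb
        obtain ⟨-, h2, h3⟩ := (hw v i).1 hb
        exact hp (h3 ▸ hhp i h2)
    · constructor
      · intro hb
        exact ⟨h i, hhn i hb, (hw _ i).2 ⟨((hlam r i).1 hb).1, hb, rfl⟩⟩
      · rintro ⟨v, hv, hb⟩
        exact ((hw v i).1 hb).2.1
    · exact ((hw u i).1 h1).2.2.symm.trans ((hw v i).1 h2).2.2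
  refine ⟨col, hcolM, U, hUM, Bs, hBsM, τ, hτM, ⟨fun x hx hx' => ?_, ?_⟩, ⟨fun d hd hUd => ?_,
    fun x hx hx' hB d hd hUd => ?_⟩, ?_, μ, fun r hr => ?_, fun i => ?_, ?_⟩
  · have hlt := fM x hx hx'
    exact ⟨f x, hlt, (colBit x hx hx' _ (by omega)).2 rfl, (UBit _ hlt).2 ⟨x, hx, rfl⟩,
      fun d hd hb => ((colBit x hx hx' d (by omega)).1 hb).symm⟩
  · rintro x hx y hy hx' hy' he d hd ⟨h1, h2⟩
    rw [colBit x hx hx' d (by omega)] at h1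
    rw [colBit y hy hy' d (by omega)] at h2
    exact proper x hx y hy he (κf x y (by omega) (h1.trans h2.symm))
  · obtain ⟨u, hu, hfu⟩ := (UBit d hd).1 hUd
    obtain ⟨v, hv, hvu, hb⟩ := bVertex u hu
    have hfv : f v = d := (fκ v u hvu).trans hfu
    by_cases hv' : Marked A n v
    · exact Or.inr ⟨v, hv, hv', (BsBit v hv hv').2 hb, (colBit v hv hv' d (by omega)).2 hfv⟩
    · exact Or.inl (taskBit v hv hv' _ (by omega) d hd ⟨hfv, Or.inr (Or.inr ⟨rfl, hb⟩)⟩)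
  · obtain ⟨u, hu, hfu⟩ := (UBit d hd).1 hUd
    by_cases hne : κ u = κ x
    · exact Or.inl ((colBit x hx hx' d (by omega)).2 ((fκ _ _ hne).symm.trans hfu))
    · right
      obtain ⟨y, hy, he, hyu⟩ := (BsBit x hx hx').1 hB u hu hne
      have hfy : f y = d := (fκ y u hyu).trans hfu
      by_cases hy' : Marked A n y
      · exact Or.inl (seenBit x hx y hy hy' he d hd hfy)
      · exact Or.inr (taskBit y hy hy' _ (by have := rlt x hx hx'; omega) d hd
          ⟨hfy, Or.inl ⟨x, hx, hx', rfl, he⟩⟩)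
  · -- the number of colors
    have hlab : IsLabeling A n m ρ f (fun d => U.testBit d = true) (fun r => lamR r m m) := by
      refine ⟨fM, fun v hv hlt => (UBit _ hlt).2 ⟨v, hv, rfl⟩, fun r hr hr' => ⟨?_, ?_⟩,
        fun d hd hUd => (UBit d hd).1 hUd, fun v _ => fle v⟩
      · rintro ⟨v, hv, hp, h, -⟩
        exact ⟨v, hv, hp, h⟩
      · rintro ⟨v, hv, hp, h⟩
        exact ⟨v, hv, hp, h, Or.inr (Or.inl rfl)⟩
    have h1 : ((Finset.range n).image (extendLabeling m ρ f)).card = k := by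
      rw [← card_image]
      -- The extended labeling has the same color classes as κ; the converse direction needs
      -- `privEq`.
      apply le_antisymm <;> refine card_image_le_of_imp fun u hu v hv h => ?_
      · rw [Finset.mem_range] at hu hv
        have h2 := fκ u v h
        by_cases h3 : f u < m
        · simp [extendLabeling, ← h2, h3]
        · have h4 := fle u
          simp only [extendLabeling, ← h2, h3, if_false]
          rw [samePart u hu v hv (privUnmarked u hu (by omega)) (privUnmarked v hv (by omega)) h]
      · rw [Finset.mem_range] at hu hv
        have h4 := fle u
        have h5 := fle v
        simp only [extendLabeling] at h
        split_ifs at h with h2 h3 h3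
        · exact κf u v h2 h
        · omega
        · omega
        · exact privEq u hu v hv (by omega) (by omega) (by omega)
    rw [HasNumColors, ← h1, hlab.card_image hρ hρ']
    have h2 : Nat.count (Bit A n τ (m + 2)) m =
        Nat.count (fun r => IsRep A n r ∧ ¬ lamR r m m) n := by
      simp only [Nat.count_eq_card_filter_range]
      symm
      have tok : ∀ r < n, IsRep A n r → ¬ lamR r m m → f r < m := by
        intro r hr hr' h
        refine lt_of_le_of_ne (fle r) fun h2 => h ?_
        exact ⟨r, hr, ⟨hr'.1, hA.irrefl r hr⟩, h2, Or.inr (Or.inl rfl)⟩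
      refine Finset.card_nbij f ?_ ?_ ?_
      · intro r hr
        simp only [Finset.mem_range, Finset.coe_filter, Set.mem_ofPred_eq] at hr ⊢
        have hlt := tok r hr.1 hr.2.1 hr.2.2
        exact ⟨hlt, (τBit _ (by omega) _ (by omega)).2
          ⟨r, hr.1, hr.2.1, hlt, Or.inr ⟨rfl, rfl, hr.2.2⟩⟩⟩
      · intro r hr r' hr' heq
        simp only [Finset.mem_range, Finset.coe_filter, Set.mem_ofPred_eq] at hr hr'
        have h3 := samePart r hr.1 r' hr'.1 hr.2.1.1 hr'.2.1.1
          (κf r r' (tok r hr.1 hr.2.1 hr.2.2) heq)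
        rwa [hρ' r hr.1 hr.2.1 r hr.1 ⟨hr.2.1.1, hA.irrefl r hr.1⟩,
          hρ' r' hr'.1 hr'.2.1 r' hr'.1 ⟨hr'.2.1.1, hA.irrefl r' hr'.1⟩] at h3
      · intro d hd
        simp only [Finset.mem_range, Finset.coe_filter, Set.mem_ofPred_eq] at hd
        obtain ⟨r, hr, hr', -, ⟨h3, -⟩ | ⟨-, h3, h4⟩⟩ :=
          (τBit _ (by omega) _ (by omega)).1 hd.2
        · omega
        · refine ⟨r, ?_, h3⟩
          simp only [Finset.mem_range, Finset.coe_filter, Set.mem_ofPred_eq]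
          exact ⟨hr, hr', h4⟩
    change Nat.count _ m + _ = _ + Nat.count (Bit A n τ (m + 2)) m
    rw [h2]
    simp only [Nat.count_eq_card_filter_range]
    rw [add_assoc, ← Finset.filter_filter, ← Finset.filter_filter,
      Finset.card_filter_add_card_filter_not]
  · -- the parts fulfill their tasks
    by_cases hr' : IsRep A n r
    · refine Or.inr ⟨hr', lam r, hlamM r, serve r hr hr', fun a ha d hd => ?_, ?_⟩
      · rw [μBit r a (by omega) d (by omega), lamBit r a (by omega) d (by omega)]
        constructor
        · rintro ⟨-, -, ⟨-, h⟩ | ⟨h, -⟩⟩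
          · exact h
          · omega
        · intro h
          exact ⟨hr', hd, Or.inl ⟨ha, h⟩⟩
      · by_cases hP : lamR r m m
        · left
          obtain ⟨u, hu, hu', hru, hfu⟩ := lamPart r hr hr' _ _ hP
          refine ⟨(lamBit r _ (by omega) _ (by omega)).2 hP,
            (lamBit r _ (by omega) _ (by omega)).2 ?_, fun x hx hx' hB =>
            (lamBit r _ (by have := rlt x hx hx'; omega) _ (by omega)).2 ?_, fun d hd hb => ?_⟩
          · obtain ⟨v, hv, hv', hfv, hrv, -, hb⟩ := privB u hu hfu
            exact ⟨v, hv, inPart v hv hv' r (hrv.trans hru), hfv, Or.inr (Or.inr ⟨rfl, hb⟩)⟩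
          · have hfx := fM x hx hx'
            obtain ⟨y, hy, he, hy', hfy, hry⟩ := seesPriv x hx ((BsBit x hx hx').1 hB) u hu hfu
              fun h => by have := fκ _ _ h; omega
            exact ⟨y, hy, inPart y hy hy' r (hry.trans hru), hfy, Or.inl ⟨x, hx, hx', rfl, he⟩⟩
          · obtain ⟨-, -, ⟨h, -⟩ | ⟨-, -, h⟩⟩ := (μBit r _ (by omega) d (by omega)).1 hb
            · omega
            · exact h hP
        · right
          have hlt : f r < m := lt_of_le_of_ne (fle r) fun h2 =>
            hP ⟨r, hr, ⟨hr'.1, hA.irrefl r hr⟩, h2, Or.inr (Or.inl rfl)⟩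
          refine ⟨fun h => hP ((lamBit r _ (by omega) _ (by omega)).1 h), f r, hlt,
            (μBit r _ (by omega) _ (by omega)).2 ⟨hr', hlt, Or.inr ⟨rfl, rfl, hP⟩⟩,
            fun d hd hb => ?_⟩
          obtain ⟨-, -, ⟨h, -⟩ | ⟨-, h, -⟩⟩ := (μBit r _ (by omega) d (by omega)).1 hb
          · omega
          · exact h.symm
    · refine Or.inl ⟨hr', Nat.eq_of_testBit_eq fun i => ?_⟩
      rw [Nat.zero_testBit, Bool.eq_false_iff]
      intro hb
      exact hr' ((hμ r i).1 hb).2.1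
  · rw [hτ]
    constructor
    · rintro ⟨hi, r, hr, h⟩
      exact ⟨r, hr, (hμ r i).2 ⟨hi, h⟩⟩
    · rintro ⟨r, hr, h⟩
      obtain ⟨hi, h⟩ := (hμ r i).1 h
      exact ⟨hi, r, hr, h⟩
  · intro r hr r' hr' i h1 h2
    obtain ⟨-, h1⟩ := (hμ r i).1 h1
    obtain ⟨-, h2⟩ := (hμ r' i).1 h2
    obtain ⟨v, hv, hv', rfl, hfv⟩ := muPart r hr _ _ h1
    obtain ⟨u, hu, hu', rfl, hfu⟩ := muPart r' hr' _ _ h2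
    -- Any shared entry, token or not, exhibits a vertex of its color in each of the two parts.
    exact samePart v hv u hu hv' hu' (κf v u (by have := h1.2.1; omega) (hfv.trans hfu.symm))

end BColoring

namespace BColoring

/-! ### The input graph -/

/-- The positions of the nonzero entries of the adjacency matrix. -/
def adjacencyCode {n : ℕ} (G : SimpleGraph (Fin n)) (m : ℕ) : Prop :=
  ∃ i j : Fin n, G.Adj i j ∧ m = (i : ℕ) * n + (j : ℕ)

variable {n : ℕ} {G : SimpleGraph (Fin n)}

theorem edge_adjacencyCode (u v : Fin n) : Edge (adjacencyCode G) n u v ↔ G.Adj u v := by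
  constructor
  · rintro ⟨i, j, h, he⟩
    have h1 := congrArg (· % n) he
    have h2 := congrArg (· / n) he
    have hn : 0 < n := by have := u.2; omega
    simp only [Nat.mul_add_mod', Nat.mod_eq_of_lt v.2, Nat.mod_eq_of_lt j.2] at h1
    simp only [mul_comm _ n, Nat.mul_add_div hn, Nat.div_eq_of_lt v.2, Nat.div_eq_of_lt j.2,
      add_zero] at h2
    rwa [Fin.ext h1, Fin.ext h2]
  · intro h
    exact ⟨u, v, h, rfl⟩

theorem isGraphCode_adjacencyCode : IsGraphCode (adjacencyCode G) n where
  symm i hi j hj h :=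
    (edge_adjacencyCode ⟨j, hj⟩ ⟨i, hi⟩).2 ((edge_adjacencyCode ⟨i, hi⟩ ⟨j, hj⟩).1 h).symm
  irrefl i hi h := G.irrefl ((edge_adjacencyCode ⟨i, hi⟩ ⟨i, hi⟩).1 h)

theorem numMarked_le_three_mul_distToCocluster :
    numMarked (adjacencyCode G) n ≤ 3 * distToCocluster G := by
  obtain ⟨S, hS, hc⟩ : distToCocluster G ∈
      {m : ℕ | ∃ S : Finset (Fin n), IsCoclusterModulator G S ∧ S.card = m} := by
    -- All vertices together form a modulator, so the infimum is attained.
    refine Nat.sInf_mem ⟨_, Finset.univ, ?_, rfl⟩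
    refine ⟨fun a => absurd a.2 (by simp)⟩
  rw [← hc, ← Finset.card_map Fin.valEmbedding]
  refine numMarked_le fun a ha b hb c hc ⟨h1, h2, h3⟩ => ?_
  rw [edge_adjacencyCode ⟨a, ha⟩ ⟨b, hb⟩] at h1
  rw [edge_adjacencyCode ⟨a, ha⟩ ⟨c, hc⟩] at h2
  rw [edge_adjacencyCode ⟨b, hb⟩ ⟨c, hc⟩] at h3
  by_contra hn
  have hmem : ∀ x (hx : x < n), ¬ x ∈ S.map Fin.valEmbedding → (⟨x, hx⟩ : Fin n) ∈ (S : Set _)ᶜ :=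
    fun x hx h hS => h (Finset.mem_map.2 ⟨⟨x, hx⟩, hS, rfl⟩)
  push Not at hn
  have h4 : ¬ (G.induce ((S : Set (Fin n))ᶜ)).Adj ⟨⟨b, hb⟩, hmem b hb hn.2.1⟩
      ⟨⟨a, ha⟩, hmem a ha hn.1⟩ := fun h => h1 (G.adj_symm h)
  have h5 : ¬ (G.induce ((S : Set (Fin n))ᶜ)).Adj ⟨⟨a, ha⟩, hmem a ha hn.1⟩
      ⟨⟨c, hc⟩, hmem c hc hn.2.2⟩ := h2
  exact hS.trans _ _ _ h4 h5 h3

theorem isBVertex_iff {V : Type*} {G : SimpleGraph V} {k : ℕ} {χ : V → Fin k} {u : V} :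
    IsBVertex G χ u ↔ ∀ c, c ≠ χ u → ∃ y, G.Adj u y ∧ χ y = c := by
  rw [IsBVertex, Set.eq_univ_iff_forall]
  refine forall_congr' fun c => ?_
  rw [Set.image_insert_eq, Set.mem_insert_iff, or_iff_not_imp_left]
  rfl

/-- A b-coloring uses all k colors, since each has a b-vertex. Conversely, colors may be arbitrary
numbers, because the image is renamed bijectively to `Fin k`. -/
theorem hasBColoring_iff {k : ℕ} :
    HasBColoring G k ↔ ∃ κ, IsNatBColoring (adjacencyCode G) n k κ := by
  classical
  constructor
  · rintro ⟨χ, hp, hb⟩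
    let κ : ℕ → ℕ := fun v => if h : v < n then χ ⟨v, h⟩ else 0
    have hκ : ∀ v (h : v < n), κ v = χ ⟨v, h⟩ := fun v h => dif_pos h
    refine ⟨κ, fun u hu v hv he h => ?_, fun u hu => ?_, ?_⟩
    · rw [hκ u hu, hκ v hv] at h
      exact hp _ _ ((edge_adjacencyCode ⟨u, hu⟩ ⟨v, hv⟩).1 he) (Fin.ext h)
    · obtain ⟨v, hv, hbv⟩ := hb (χ ⟨u, hu⟩)
      refine ⟨v, v.2, by rw [hκ u hu, hκ v v.2, ← hv], fun w hw hne => ?_⟩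
      rw [hκ w hw, hκ v v.2] at hne
      obtain ⟨y, hy, hyw⟩ := isBVertex_iff.1 hbv (χ ⟨w, hw⟩) fun h => hne (congrArg Fin.val h)
      exact ⟨y, y.2, (edge_adjacencyCode v y).2 hy, by rw [hκ w hw, hκ y y.2, ← hyw]⟩
    · have : (Finset.range n).image κ = Finset.range k := by
        ext c
        simp only [Finset.mem_image, Finset.mem_range]
        constructor
        · rintro ⟨v, hv, rfl⟩
          rw [hκ v hv]
          exact (χ _).2
        · intro hc
          obtain ⟨u, hu, -⟩ := hb ⟨c, hc⟩
          exact ⟨u, u.2, by rw [hκ u u.2]; exact congrArg Fin.val hu⟩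
      rw [this, Finset.card_range]
  · rintro ⟨κ, hp, hb, hcard⟩
    let e := Finset.equivFinOfCardEq hcard
    have hmem : ∀ v : Fin n, κ v ∈ (Finset.range n).image κ := fun v =>
      Finset.mem_image_of_mem _ (Finset.mem_range.2 v.2)
    have heq : ∀ u v : Fin n, e ⟨κ u, hmem u⟩ = e ⟨κ v, hmem v⟩ ↔ κ u = κ v := fun u v => by
      rw [e.apply_eq_iff_eq, Subtype.mk.injEq]
    have hsurj : ∀ c, ∃ u : Fin n, e ⟨κ u, hmem u⟩ = c := by
      intro c
      obtain ⟨u, hu, huc⟩ := Finset.mem_image.1 (e.symm c).2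
      refine ⟨⟨u, Finset.mem_range.1 hu⟩, ?_⟩
      rw [← e.eq_symm_apply]
      exact Subtype.ext huc
    refine ⟨fun v => e ⟨κ v, hmem v⟩, fun u v h he => ?_, fun c => ?_⟩
    · exact hp u u.2 v v.2 ((edge_adjacencyCode u v).2 h) ((heq u v).1 he)
    · obtain ⟨u, rfl⟩ := hsurj c
      obtain ⟨v, hv, hvu, hbv⟩ := hb u u.2
      refine ⟨⟨v, hv⟩, (heq ⟨v, hv⟩ u).2 hvu, isBVertex_iff.2 fun c hc => ?_⟩
      obtain ⟨w, rfl⟩ := hsurj c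
      obtain ⟨y, hy, he, hyw⟩ := hbv w w.2 fun h => hc ((heq w ⟨v, hv⟩).2 h)
      exact ⟨⟨y, hy⟩, (edge_adjacencyCode ⟨v, hv⟩ ⟨y, hy⟩).1 he, (heq ⟨y, hy⟩ w).2 hyw⟩

/-- The number of bits of the numbers encoding a coloring. -/
noncomputable def codeLength (A : ℕ → Prop) (n : ℕ) : ℕ := (numMarked A n + 3) * (numMarked A n + 1)

/-- The decision procedure is correct, even if large values of `k` are replaced by `n + 1`. -/
theorem hasCertificate_iff_hasBColoring (k : ℕ) :
    HasCertificate (adjacencyCode G) n (k - (k - (n + 1))) (2 ^ codeLength (adjacencyCode G) n) ↔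
      HasBColoring G k := by
  have hle : ∀ {k κ}, IsNatBColoring (adjacencyCode G) n k κ → k ≤ n := fun h => by
    rw [← h.card_image]
    exact Finset.card_image_le.trans (Finset.card_range n).le
  rw [hasBColoring_iff]
  constructor
  · intro h
    -- The argument is min(k, n + 1). A coloring has at most n colors, so the minimum is not n + 1
    -- and equals k.
    obtain ⟨κ, hκ⟩ := exists_natBColoring_of_hasCertificate isGraphCode_adjacencyCode h
    have := hle hκ
    rw [show k - (k - (n + 1)) = k by omega] at hκ
    exact ⟨κ, hκ⟩
  · rintro ⟨κ, hκ⟩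
    have := hle hκ
    rw [show k - (k - (n + 1)) = k by omega]
    exact hasCertificate_of_isNatBColoring isGraphCode_adjacencyCode hκ

end BColoring

/-! ### The program and its running time. -/

namespace RAM

open BColoring

theorem PolyTime.codeLength {Γ : Type} [Ctx Γ] {A : Γ → ℕ → Prop} {n : Γ → ℕ} (hA : IsStored A)
    (hn : PolyTime n) : PolyTime fun γ => codeLength (A γ) (n γ) :=
  .mul ((PolyTime.numMarked hA hn).add (.const 3)) ((PolyTime.numMarked hA hn).add (.const 1))

/-- A program for `b`-coloring whose running time is polynomial in `n` and in the number of
possible codes of colorings. -/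
theorem exists_prog : ∃ (alg : Prog) (D : ℕ), ∀ (n : ℕ) (G : SimpleGraph (Fin n)) (k : ℕ),
    DecidesWithin alg (graphInput G k) (HasBColoring G k)
      ((4 * (n + 1) * 2 ^ codeLength (adjacencyCode G) n) ^ D) := by
  classical
  obtain ⟨-, T₁, ⟨C₁, hC₁⟩, h₁⟩ := PolyTime.codeLength (Γ := (Unit × (ℕ → Prop)) × ℕ)
    IsStored.snd.fst PolyTime.snd
  obtain ⟨p₁, hp₁⟩ := h₁ (((), 0), 0) 2 1 ⟨⟨trivial, by simp⟩, by simp⟩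
  obtain ⟨-, T₂, ⟨C₂, hC₂⟩, h₂⟩ := PolyDec.hasCertificate
    (Γ := (((Unit × (ℕ → Prop)) × ℕ) × ℕ) × ℕ)
    IsStored.snd.fst.fst.fst PolyTime.snd.fst.fst PolyTime.snd.fst PolyTime.snd
  obtain ⟨p₂, hp₂⟩ := h₂ (((((), 0), 0), 1), 3) 4 1
    ⟨⟨⟨⟨trivial, by simp⟩, by simp⟩, by simp⟩, by simp⟩
  -- Time is polynomial in the values of the inputs, so k is first capped at n + 1. The power 2 ^ L
  -- is not polynomial in n; a separate doubling loop produces it, and the search receives it as an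
  -- input.
  refine ⟨.seq (.set 1 (.sub (.reg 1) (.sub (.reg 1) (.add (.reg 0) (.const 1)))))
    (.seq p₁ (.seq (.set 3 (.const 1)) (.seq
      (.loop (.reg 2) (.seq (.set 3 (.add (.reg 3) (.reg 3))) (.set 2 (.sub (.reg 2) (.const 1)))))
      (.seq p₂ (.set 0 (.reg 4)))))), C₁ + C₂ + 2, fun n G k => ?_⟩
  set A := adjacencyCode G with hA
  set L := codeLength A n with hL
  set k' := k - (k - (n + 1)) with hk'
  have h0 : ∀ i, (graphInput G k).arr 0 i ≠ 0 ↔ A i := by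
    intro i
    simp [graphInput, hA, adjacencyCode]
  have main : Runs (.seq (.set 1 (.sub (.reg 1) (.sub (.reg 1) (.add (.reg 0) (.const 1)))))
    (.seq p₁ (.seq (.set 3 (.const 1)) (.seq
      (.loop (.reg 2) (.seq (.set 3 (.add (.reg 3) (.reg 3))) (.set 2 (.sub (.reg 2) (.const 1)))))
      (.seq p₂ (.set 0 (.reg 4))))))) (graphInput G k)
      (1 + (T₁ (((), A), n) + (1 + ((L * (2 + 1) + 1) + (T₂ (((((), A), n), k'), 2 ^ L) + 1)))))
      fun s => s.reg 0 = if HasBColoring G k then 1 else 0 := by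
    refine Runs.seq (Runs.set (Runs.seq ((hp₁ (((), A), n) _ ?_).mono le_rfl ?_)))
    · exact ⟨⟨trivial, h0⟩, by simp [graphInput]⟩
    rintro s₁ ⟨h1, h2⟩
    have h3 : s₁.reg 0 = n := by rw [h2.1 0 (by omega)]; simp [graphInput]
    have h4 : s₁.reg 1 = k' := by rw [h2.1 1 (by omega)]; simp [graphInput, Expr.eval, hk']
    have h5 : ∀ i, s₁.arr 0 i ≠ 0 ↔ A i := by rw [h2.2 0 (by omega)]; exact h0
    refine Runs.seq (Runs.set (Runs.seq ((Runs.loop (T := 2) (fun j s => s.reg 0 = n ∧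
      s.reg 1 = k' ∧ s.arr 0 = s₁.arr 0 ∧ s.reg 2 = L - j ∧ s.reg 3 = 2 ^ j) L ?_ ?_ ?_).mono
      le_rfl ?_)))
    · rintro j hj s ⟨i1, i2, i3, i4, i5⟩
      refine ⟨by simp only [Expr.eval, i4]; omega, Runs.seq (T₁ := 1) (T₂ := 1)
        (Runs.set (Runs.set ?_))⟩
      refine ⟨by simpa using i1, by simpa using i2, i3, ?_, ?_⟩
      · simp [Expr.eval, i4]
        omega
      · simp [Expr.eval, i5, pow_succ, mul_two]
    · rintro s ⟨-, -, -, i4, -⟩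
      simp [Expr.eval, i4]
    · refine ⟨by simpa using h3, by simpa using h4, rfl, ?_, by simp [Expr.eval]⟩
      simpa using h1
    · rintro s₂ ⟨i1, i2, i3, i4, i5⟩
      refine Runs.seq ((hp₂ (((((), A), n), k'), 2 ^ L) s₂ ?_).mono le_rfl ?_)
      · exact ⟨⟨⟨⟨trivial, by rw [i3]; exact h5⟩, i1⟩, i2⟩, i5⟩
      · rintro s₃ ⟨j1, -⟩
        refine Runs.set ?_
        simp only [Expr.eval, State.setReg_reg, if_true, j1]
        exact if_congr (hasCertificate_iff_hasBColoring k) rfl rfl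
  obtain ⟨s, t, he, ht, hs⟩ := main
  refine ⟨s, t, he, ht.trans ?_, fun h => by rw [hs, if_pos h], fun h => by rw [hs, if_neg h]⟩
  have hM : 1 ≤ 2 ^ L := Nat.one_le_two_pow
  have hLM : L < 2 ^ L := Nat.lt_two_pow_self
  generalize 2 ^ L = M at *
  -- The left side is the base of the polynomial bound for the search, whose context consists of n,
  -- k' and M.
  have hY : n + k' + M + 2 ≤ 4 * (n + 1) * M := by
    have : k' ≤ n + 1 := by omega
    nlinarith
  have hY' : 4 * M ≤ 4 * (n + 1) * M := by nlinarith
  have b1 : T₁ (((), A), n) ≤ (4 * (n + 1) * M) ^ C₁ :=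
    (hC₁ _).trans (Nat.pow_le_pow_left (by simp [Ctx.size]; nlinarith) _)
  have b2 : T₂ (((((), A), n), k'), M) ≤ (4 * (n + 1) * M) ^ C₂ :=
    (hC₂ _).trans (Nat.pow_le_pow_left (by simp [Ctx.size]; omega) _)
  have b4 : 4 ≤ 4 * (n + 1) * M := by nlinarith
  generalize 4 * (n + 1) * M = Y at *
  have b5 : Y ^ C₁ ≤ Y ^ (C₁ + C₂ + 1) := Nat.pow_le_pow_right (by omega) (by omega)
  have b6 : Y ^ C₂ ≤ Y ^ (C₁ + C₂ + 1) := Nat.pow_le_pow_right (by omega) (by omega)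
  have b7 : Y ^ 1 ≤ Y ^ (C₁ + C₂ + 1) := Nat.pow_le_pow_right (by omega) (by omega)
  rw [pow_one] at b7
  have b8 : Y ^ (C₁ + C₂ + 2) = Y ^ (C₁ + C₂ + 1) * Y := pow_succ _ _
  generalize Y ^ (C₁ + C₂ + 1) = Z at *
  have b9 : Z * 4 ≤ Z * Y := Nat.mul_le_mul_left _ b4
  omega

/-- The quadratic code length is absorbed by p + 1 ≤ 2 ^ p. The summand 9 D is for p = 0, where the
power is only 1. -/
theorem codeLength_mul_le {n : ℕ} (G : SimpleGraph (Fin n)) (D : ℕ) :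
    codeLength (adjacencyCode G) n * D ≤ 9 * D + 2 ^ ((9 * D + 2) * distToCocluster G) := by
  have h := numMarked_le_three_mul_distToCocluster (G := G)
  rw [codeLength]
  generalize numMarked (adjacencyCode G) n = m at *
  generalize distToCocluster G = p at *
  have h1 : (m + 3) * (m + 1) ≤ 9 * ((p + 1) * (p + 1)) := by nlinarith
  rcases Nat.eq_zero_or_pos p with rfl | hp
  · exact (Nat.mul_le_mul_right D h1).trans ((by ring : _ = 9 * D).le.trans (Nat.le_add_right _ _))
  · have h2 : p + 1 ≤ 2 ^ p := Nat.lt_two_pow_self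
    have h3 : 9 * D ≤ 2 ^ (9 * D * p) :=
      Nat.lt_two_pow_self.le.trans (Nat.pow_le_pow_right (by omega) (Nat.le_mul_of_pos_right _ hp))
    have h4 : 2 ^ ((9 * D + 2) * p) = 2 ^ (9 * D * p) * (2 ^ p * 2 ^ p) := by
      rw [← pow_add, ← pow_add]
      congr 1
      ring
    calc (m + 3) * (m + 1) * D ≤ 9 * ((p + 1) * (p + 1)) * D := Nat.mul_le_mul_right _ h1
      _ = 9 * D * ((p + 1) * (p + 1)) := by ring
      _ ≤ 2 ^ (9 * D * p) * (2 ^ p * 2 ^ p) := Nat.mul_le_mul h3 (Nat.mul_le_mul h2 h2)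
      _ ≤ _ := by rw [h4]; omega

end RAM

theorem theorem3p1 :
    ∃ (alg : RAM.Prog) (C : ℕ), ∀ (n : ℕ) (G : SimpleGraph (Fin n)) (k : ℕ),
      RAM.DecidesWithin alg (RAM.graphInput G k) (BColoring.HasBColoring G k)
        (C * 2 ^ 2 ^ (C * BColoring.distToCocluster G) * (n + 1) ^ C) := by
  obtain ⟨alg, D, h⟩ := RAM.exists_prog
  -- One constant dominates the leading factor 4 ^ D * 2 ^ (9 * D), the coefficient 9 D + 2 of p and
  -- the exponent D of n + 1.
  refine ⟨alg, 4 ^ D * 2 ^ (9 * D) + (9 * D + 2), fun n G k => ?_⟩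
  obtain ⟨s, t, he, ht, hs⟩ := h n G k
  refine ⟨s, t, he, ht.trans ?_, hs⟩
  have h1 := RAM.codeLength_mul_le G D
  have hD : D < 2 ^ D := Nat.lt_two_pow_self
  set C := 4 ^ D * 2 ^ (9 * D) + (9 * D + 2) with hC
  set p := BColoring.distToCocluster G
  calc (4 * (n + 1) * 2 ^ BColoring.codeLength (BColoring.adjacencyCode G) n) ^ D
      = 4 ^ D * 2 ^ (BColoring.codeLength (BColoring.adjacencyCode G) n * D) * (n + 1) ^ D := by
        rw [mul_pow, mul_pow, ← pow_mul]
        ring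
    _ ≤ 4 ^ D * 2 ^ (9 * D + 2 ^ ((9 * D + 2) * p)) * (n + 1) ^ D :=
        Nat.mul_le_mul_right _ (Nat.mul_le_mul_left _ (Nat.pow_le_pow_right (by omega) h1))
    _ = 4 ^ D * 2 ^ (9 * D) * 2 ^ 2 ^ ((9 * D + 2) * p) * (n + 1) ^ D := by
        rw [pow_add 2 (9 * D), ← mul_assoc (4 ^ D)]
    _ ≤ C * 2 ^ 2 ^ (C * p) * (n + 1) ^ C := by
        refine Nat.mul_le_mul (Nat.mul_le_mul (by omega) (Nat.pow_le_pow_right (by omega)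
          (Nat.pow_le_pow_right (by omega) (Nat.mul_le_mul_right _ (by omega)))))
          (Nat.pow_le_pow_right (by omega) (by omega))
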